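/- For $x\in\mathbb R$ (or $x\in\mathbb T=\mathbb R/\mathbb Z$) let $\|x\|$ denote the distance from $x$ to the nearest integer, and let $\mathrm{mes}$ be Lebesgue measure on $\mathbb T$, with $\mathrm{mes}\,\mathbb T=1$. For every $A\in\mathbb R$ there is $\sigma=\sigma(A)>0$ such that for all $c>0$ and $B\in\mathbb R$ there is $\tilde c=\tilde c(A,c,B)>0$ with the following property. Let $u:\mathbb T\to\mathbb R$, regarded as a 1-periodic function on $\mathbb R$, have an extension $\tilde u$ to the strip $|\mathrm{Im}\,z|<1$ that is subharmonic there and satisfies $|\tilde u|\le B$, and put $\hat u(0)=\int_{\mathbb T}u(x)\,dx$. Let $M\ge 1$ be an integer and let $\omega\in\mathbb T$ satisfy $$\|k\omega\|>c|k|^{-A}\qquad\text{for all } k\in\mathbb Z \text{ with } 0<|k|\le M.$$ Then $$\mathrm{mes}\Big\{x\in\mathbb T:\ \Big|\sum_{|m|<M}\frac{M-|m|}{M^2}\,u(x+m\omega)-\hat u(0)\Big|>M^{-\sigma}\Big\}<e^{-\tilde c M^{\sigma}}.$$ In particular, if $\|k\omega\|>c|k|^{-A}$ holds for all $k\in\mathbb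 Z\setminus\{0\}$, then this estimate holds for all integers $M\ge1$, with $\sigma$ depending only on $A$ and $\tilde c$ only on $A,c,B$. -/

import Mathlib

/-- A real-valued function `f` is subharmonic on the open set `U ⊆ ℂ` if it is upper
semicontinuous on `U` and its value at the centre of any closed disc contained in `U` is at most
its average over the boundary circle. (For a subharmonic function that is finite everywhere these
averages are finite, so integrability on the circles is part of the notion.) -/
structure SubharmonicOn (f : ℂ → ℝ) (U : Set ℂ) : Prop where
  isOpen : IsOpen U
  upperSemicontinuousOn : UpperSemicontinuousOn f U
  circleIntegrable : ∀ (z : ℂ) (r : ℝ), 0 < r → Metric.closedBall z r ⊆ U → CircleIntegrable f z r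
  le_circleAverage : ∀ (z : ℂ) (r : ℝ), 0 < r → Metric.closedBall z r ⊆ U →
    f z ≤ Real.circleAverage f z r

/-- `v` is a subharmonic extension, bounded by `B` in absolute value, of the 1-periodic function
`u` to the strip `|Im z| < 1`. -/
structure IsBoundedSubharmonicExtension (v : ℂ → ℝ) (u : UnitAddCircle → ℝ) (B : ℝ) : Prop where
  subharmonicOn : SubharmonicOn v {z : ℂ | |z.im| < 1}
  abs_le : ∀ z : ℂ, |z.im| < 1 → |v z| ≤ B
  extends_real : ∀ x : ℝ, v (x : ℂ) = u (x : UnitAddCircle)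

/-- The Fejér-weighted average `∑_{|m| < M} (M - |m|) / M² · u (x + m ω)` along the rotation by
`ω`. -/
noncomputable def fejerAverage (u : UnitAddCircle → ℝ) (ω : UnitAddCircle) (M : ℕ)
    (x : UnitAddCircle) : ℝ :=
  ∑ m ∈ Finset.Ioo (-(M : ℤ)) (M : ℤ), ((M : ℝ) - |(m : ℝ)|) / (M : ℝ) ^ 2 * u (x + m • ω)

open MeasureTheory AddCircle

/-! ### Fourier coefficients on the unit circle -/

/-! The only information about `u` that is used is `|u| ≤ B` and a bound on its `H^{1/2}` energy, `∑
|k| |û(k)|² ≤ E` with `E` a constant times `B²`.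

Energy bound. A bounded function with the sub-mean-value property has gradient in `L²` locally
(Caccioppoli, `integral_cutoff_mul_fderiv_sq_le`), and the trace on a line of a function with square
integrable gradient lies in `H^{1/2}` (`sum_abs_mul_sq_norm_trace_le`). The extension need not be
periodic off the real axis, so the trace is cut off to `[0,2]` by `κ(x) = sin²(πx/2)`; since `κ(x) +
κ(x+1) = 1`, folding back to the circle returns `û(k)`. Radial mollification supplies the
smoothness, and upper semicontinuity lets the mollified traces converge pointwise to `u`.

Large `M`. The average multiplies `û(k)` by a Fejér kernel value `D(k)` with `|D(k)| ≤ min(1,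
(2M‖kω‖)⁻²)`. Split the frequencies at `K`. For `0 < |k| ≤ K`, Cauchy–Schwarz bounds the partial sum
uniformly by the square root of `E · ∑ |D(k)|/|k|`. The Diophantine condition up to `R ≈
M^{1/(1+A)}` separates the points `kω`, which makes this last sum `O(log K / R)`
(`sum_norm_fejerMultiplier_div_le`). The frequencies beyond `K` have squared `L²` norm at most
`E/K`, and Chebyshev's inequality applies. As `K` enters the uniform bound only through its
logarithm, it may be exponentially large, `K ≈ exp(M^σ)`, and this produces the exponentially small
measure.

Small `M`. For the finitely many remaining `M` the exceptional set must have measure at most `1 - δ`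
with `δ` depending only on `B`, `E` and the threshold. This holds because functions of bounded
`H^{1/2}` energy cannot jump: a function that is almost never near its mean would pass from above
the mean to below it across a gap, and that costs too much energy (`exists_measure_near_mean_ge`).
The averages inherit the bounds of `u`, so the statement applies to them for every `ω`. -/

theorem UnitAddCircle.haarAddCircle_eq_volume :
    (haarAddCircle : Measure UnitAddCircle) = volume := by
  simp [volume_eq_smul_haarAddCircle]

theorem fourierCoeff_eq_integral_volume (f : UnitAddCircle → ℂ) (k : ℤ) :
    fourierCoeff f k = ∫ x : UnitAddCircle, fourier (-k) x * f x := by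
  rw [fourierCoeff, UnitAddCircle.haarAddCircle_eq_volume]; rfl

theorem hasSum_sq_fourierCoeff_of_bounded {f : UnitAddCircle → ℂ} (hf : Measurable f) {C : ℝ}
    (hC : ∀ x, ‖f x‖ ≤ C) :
    HasSum (fun k : ℤ => ‖fourierCoeff f k‖ ^ 2) (∫ x : UnitAddCircle, ‖f x‖ ^ 2) := by
  have hL : MemLp f 2 (haarAddCircle : Measure UnitAddCircle) :=
    MemLp.of_bound hf.aestronglyMeasurable C (Filter.Eventually.of_forall hC)
  have h := hasSum_sq_fourierCoeff (hL.toLp f)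
  rw [fourierCoeff_congr_ae hL.coeFn_toLp] at h
  convert h using 1
  rw [← UnitAddCircle.haarAddCircle_eq_volume]
  apply integral_congr_ae
  filter_upwards [hL.coeFn_toLp] with x hx
  rw [hx]

theorem fourierCoeff_comp_add_right (f : UnitAddCircle → ℂ) (t : UnitAddCircle) (k : ℤ) :
    fourierCoeff (fun x => f (x + t)) k = fourier k t * fourierCoeff f k := by
  rw [fourierCoeff_eq_integral_volume, fourierCoeff_eq_integral_volume,
    ← integral_add_right_eq_self (fun x => fourier (-k) x * f x) t, ← integral_const_mul]
  congr 1
  ext x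
  have h1 : fourier k t * fourier (-k) t = (1 : ℂ) := by
    rw [← fourier_add]; simp
  have h2 : fourier (-k) (x + t) = fourier (-k) x * fourier (-k) t := by
    simp only [fourier_apply, smul_add, toCircle_add, Circle.coe_mul]
  rw [h2]
  linear_combination (-(fourier (-k) x * f (x + t))) * h1

theorem fourier_zsmul_apply (k m : ℤ) (ω : UnitAddCircle) :
    fourier k (m • ω) = (fourier k ω : ℂ) ^ m := by
  rw [fourier_apply, fourier_apply, smul_comm, toCircle_zsmul, Circle.coe_zpow]

theorem norm_fourier_apply (k : ℤ) (x : UnitAddCircle) : ‖(fourier k x : ℂ)‖ = 1 := by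
  rw [fourier_apply, Circle.norm_coe]

theorem integrable_of_measurable_bounded {α E : Type*} [MeasurableSpace α] {μ : Measure α}
    [IsFiniteMeasure μ] [NormedAddCommGroup E] [MeasurableSpace E] [BorelSpace E]
    [SecondCountableTopology E] {f : α → E} (hf : Measurable f) {C : ℝ}
    (hC : ∀ x, ‖f x‖ ≤ C) : Integrable f μ :=
  Integrable.of_bound hf.aestronglyMeasurable C (Filter.Eventually.of_forall hC)

/-- The chord has length `2|sin(πy)|` for the representative `y` in `[-1/2, 1/2]`; Jordan's
inequality `|sin s| ≥ 2|s|/π` finishes. -/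
theorem four_mul_norm_le_norm_toCircle_sub_one (t : UnitAddCircle) :
    4 * ‖t‖ ≤ ‖(toCircle t : ℂ) - 1‖ := by
  induction t using QuotientAddGroup.induction_on with
  | H x =>
  have hx : ((x - round x : ℝ) : UnitAddCircle) = (x : UnitAddCircle) := by
    rw [AddCircle.coe_sub, sub_eq_self]
    exact (AddCircle.coe_eq_zero_iff 1).2 ⟨round x, by simp⟩
  change 4 * ‖(x : UnitAddCircle)‖ ≤ ‖(toCircle (x : UnitAddCircle) : ℂ) - 1‖
  rw [UnitAddCircle.norm_eq, ← hx, toCircle_apply_mk, Circle.coe_exp]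
  set y := x - round x with hy
  have hy2 : |y| ≤ 1 / 2 := abs_sub_round x
  rw [mul_comm _ Complex.I, Complex.norm_exp_I_mul_ofReal_sub_one, norm_mul, Real.norm_eq_abs,
    Real.norm_eq_abs]
  have h := Real.mul_abs_le_abs_sin (x := Real.pi * y)
    (by rw [abs_mul, abs_of_pos Real.pi_pos]; nlinarith [Real.pi_pos])
  rw [abs_mul, abs_of_pos Real.pi_pos] at h
  have h3 : 2 / Real.pi * (Real.pi * |y|) = 2 * |y| := by field_simp
  rw [h3] at h
  have h4 : 2 * Real.pi / 1 * y / 2 = Real.pi * y := by ring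
  rw [h4, abs_two]
  linarith

theorem norm_fourier_coe_sub_one_le (k : ℤ) (s : ℝ) :
    ‖(fourier k (s : UnitAddCircle) : ℂ) - 1‖ ≤ 2 * Real.pi * |(k : ℝ)| * |s| := by
  have h : (fourier k (s : UnitAddCircle) : ℂ) =
      Complex.exp (Complex.I * ((2 * Real.pi * k * s : ℝ) : ℂ)) := by
    rw [fourier_coe_apply]; congr 1; push_cast; ring
  rw [h]
  refine (Real.norm_exp_I_mul_ofReal_sub_one_le).trans (le_of_eq ?_)
  rw [Real.norm_eq_abs, abs_mul, abs_mul, abs_mul, abs_two, abs_of_pos Real.pi_pos]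

/-! ### The Fejér multiplier -/

/-- The Fourier multiplier of the Fejér average along the rotation by `ω`. -/
noncomputable def fejerMultiplier (ω : UnitAddCircle) (M : ℕ) (k : ℤ) : ℂ :=
  ∑ m ∈ Finset.Ioo (-(M : ℤ)) (M : ℤ),
    ((((M : ℝ) - |(m : ℝ)|) / (M : ℝ) ^ 2 : ℝ) : ℂ) * fourier k (m • ω)

theorem Finset.sum_Ioo_neg_succ {E : Type*} [AddCommGroup E] (f : ℤ → E) {M : ℕ} (hM : 1 ≤ M) :
    ∑ m ∈ Finset.Ioo (-((M + 1 : ℕ) : ℤ)) ((M + 1 : ℕ) : ℤ), f m =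
      (∑ m ∈ Finset.Ioo (-(M : ℤ)) (M : ℤ), f m) + f M + f (-M) := by
  have h : Finset.Ioo (-((M + 1 : ℕ) : ℤ)) ((M + 1 : ℕ) : ℤ) =
      insert (-(M : ℤ)) (insert (M : ℤ) (Finset.Ioo (-(M : ℤ)) (M : ℤ))) := by
    ext m; simp only [Finset.mem_Ioo, Finset.mem_insert]; push_cast; omega
  rw [h, Finset.sum_insert (by simp; omega), Finset.sum_insert (by simp)]
  abel

theorem sum_Ioo_zpow (z : ℂ) (M : ℕ) (hM : 1 ≤ M) :
    ∑ m ∈ Finset.Ioo (-(M : ℤ)) (M : ℤ), z ^ m =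
      (∑ j ∈ Finset.range M, z ^ j) + (∑ j ∈ Finset.range M, z⁻¹ ^ j) - 1 := by
  induction M, hM using Nat.le_induction with
  | base => simp [show Finset.Ioo (-1 : ℤ) 1 = {0} from rfl]
  | succ M hM ih =>
    rw [Finset.sum_Ioo_neg_succ _ hM, ih, Finset.sum_range_succ, Finset.sum_range_succ]
    simp only [zpow_natCast, zpow_neg, inv_pow]; ring

theorem pow_mul_sum_inv_pow {z : ℂ} (hz : z ≠ 0) (M : ℕ) :
    z ^ M * (∑ j ∈ Finset.range M, z⁻¹ ^ j) = (∑ j ∈ Finset.range M, z ^ j) - 1 + z ^ M := by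
  induction M with
  | zero => simp
  | succ M ih =>
    have hzM : z ^ M * z⁻¹ ^ M = 1 := by rw [← mul_pow, mul_inv_cancel₀ hz, one_pow]
    rw [Finset.sum_range_succ, Finset.sum_range_succ, pow_succ]
    linear_combination z * ih + z * hzM + (geom_sum_mul z M)

/-- The difference `m` arises from `M - |m|` pairs of exponents below `M`. In the induction, raising
`M` by one adds 1 to every weight, hence adds the full sum of `sum_Ioo_zpow`. -/
theorem sum_Ioo_triangle_mul_zpow {z : ℂ} (hz : z ≠ 0) (M : ℕ) (hM : 1 ≤ M) :
    ∑ m ∈ Finset.Ioo (-(M : ℤ)) (M : ℤ), ((((M : ℝ) - |(m : ℝ)| : ℝ)) : ℂ) * z ^ m =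
      (∑ j ∈ Finset.range M, z ^ j) * (∑ j ∈ Finset.range M, z⁻¹ ^ j) := by
  induction M, hM using Nat.le_induction with
  | base => simp [show Finset.Ioo (-1 : ℤ) 1 = {0} from rfl]
  | succ M hM ih =>
    have h : ∀ m : ℤ, (((((M + 1 : ℕ) : ℝ) - |(m : ℝ)| : ℝ)) : ℂ) * z ^ m =
        ((((M : ℝ) - |(m : ℝ)| : ℝ)) : ℂ) * z ^ m + z ^ m := fun m => by push_cast; ring
    simp only [h, Finset.sum_add_distrib]
    rw [Finset.sum_Ioo_neg_succ _ hM, ih, sum_Ioo_zpow z (M + 1) (by omega),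
      Finset.sum_range_succ, Finset.sum_range_succ]
    have hzM : z ^ M * z⁻¹ ^ M = 1 := by rw [← mul_pow, mul_inv_cancel₀ hz, one_pow]
    have e1 := pow_mul_sum_inv_pow hz M
    have e2 : z⁻¹ ^ M * (∑ j ∈ Finset.range M, z ^ j) =
        (∑ j ∈ Finset.range M, z⁻¹ ^ j) - 1 + z⁻¹ ^ M := by
      have hS : (∑ j ∈ Finset.range M, z ^ j) =
          z ^ M * (∑ j ∈ Finset.range M, z⁻¹ ^ j) + 1 - z ^ M := by rw [e1]; ring
      rw [hS]
      linear_combination (∑ j ∈ Finset.range M, z⁻¹ ^ j - 1) * hzM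
    have hab : |(((-(M : ℤ)) : ℤ) : ℝ)| = M := by simp
    simp only [hab, Int.cast_natCast, Nat.abs_cast, sub_self, Complex.ofReal_zero, zero_mul,
      add_zero]
    linear_combination -e1 - e2 - hzM

theorem fejerMultiplier_eq (ω : UnitAddCircle) {M : ℕ} (hM : 1 ≤ M) (k : ℤ) :
    fejerMultiplier ω M k = ((M : ℂ) ^ 2)⁻¹ *
      ((∑ j ∈ Finset.range M, (fourier k ω : ℂ) ^ j) *
        (∑ j ∈ Finset.range M, (fourier k ω : ℂ)⁻¹ ^ j)) := by
  have hz : (fourier k ω : ℂ) ≠ 0 := norm_pos_iff.1 (by rw [norm_fourier_apply]; norm_num)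
  rw [← sum_Ioo_triangle_mul_zpow hz M hM, fejerMultiplier, Finset.mul_sum]
  refine Finset.sum_congr rfl fun m _ => ?_
  rw [fourier_zsmul_apply]; push_cast; ring

theorem norm_fejerMultiplier_le_one (ω : UnitAddCircle) {M : ℕ} (hM : 1 ≤ M) (k : ℤ) :
    ‖fejerMultiplier ω M k‖ ≤ 1 := by
  have h1 : ‖∑ j ∈ Finset.range M, (fourier k ω : ℂ) ^ j‖ ≤ M := by
    refine (norm_sum_le _ _).trans ?_
    simp only [norm_pow, norm_fourier_apply, one_pow, Finset.sum_const, Finset.card_range,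
      nsmul_eq_mul, mul_one, le_refl]
  have h2 : ‖∑ j ∈ Finset.range M, (fourier k ω : ℂ)⁻¹ ^ j‖ ≤ M := by
    refine (norm_sum_le _ _).trans ?_
    simp only [norm_pow, norm_inv, norm_fourier_apply, inv_one, one_pow, Finset.sum_const,
      Finset.card_range, nsmul_eq_mul, mul_one, le_refl]
  have hM' : (0 : ℝ) < M := by exact_mod_cast hM
  rw [fejerMultiplier_eq ω hM, norm_mul, norm_mul, norm_inv, norm_pow, Complex.norm_natCast,
    inv_mul_le_iff₀ (by positivity)]
  calc _ ≤ (M : ℝ) * M := mul_le_mul h1 h2 (norm_nonneg _) hM'.le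
    _ = _ := by ring

/-- Each of the two geometric sums is at most `2/|z - 1| ≤ 1/(2d)`. -/
theorem norm_fejerMultiplier_le (ω : UnitAddCircle) {M : ℕ} (hM : 1 ≤ M) (k : ℤ) {d : ℝ}
    (hd : 0 < d) (hk : d ≤ ‖k • ω‖) :
    ‖fejerMultiplier ω M k‖ ≤ 1 / (4 * (M * d) ^ 2) := by
  set z : ℂ := fourier k ω with hz
  have hz1 : ‖z‖ = 1 := norm_fourier_apply k ω
  have hz0 : z ≠ 0 := norm_pos_iff.1 (by rw [hz1]; norm_num)
  have hlow : 4 * d ≤ ‖z - 1‖ := by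
    rw [hz, fourier_apply]
    exact (mul_le_mul_of_nonneg_left hk (by norm_num)).trans
      (four_mul_norm_le_norm_toCircle_sub_one _)
  have hlow' : 4 * d ≤ ‖z⁻¹ - 1‖ := by
    have : z⁻¹ - 1 = -(z⁻¹ * (z - 1)) := by field_simp; ring
    rw [this, norm_neg, norm_mul, norm_inv, hz1, inv_one, one_mul]; exact hlow
  have key : ∀ y : ℂ, ‖y‖ = 1 → 4 * d ≤ ‖y - 1‖ →
      ‖∑ j ∈ Finset.range M, y ^ j‖ ≤ 1 / (2 * d) := by
    intro y hy1 hy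
    have h := geom_sum_mul y M
    have h2 : ‖∑ j ∈ Finset.range M, y ^ j‖ * ‖y - 1‖ ≤ 2 := by
      rw [← norm_mul, h]
      refine (norm_sub_le _ _).trans ?_
      rw [norm_pow, hy1, one_pow, norm_one]; norm_num
    rw [le_div_iff₀ (by positivity)]
    nlinarith [norm_nonneg (∑ j ∈ Finset.range M, y ^ j)]
  have hM' : (0 : ℝ) < M := by exact_mod_cast hM
  rw [fejerMultiplier_eq ω hM, ← hz, norm_mul, norm_mul, norm_inv, norm_pow, Complex.norm_natCast]
  calc _ ≤ ((M : ℝ) ^ 2)⁻¹ * (1 / (2 * d) * (1 / (2 * d))) := by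
        gcongr
        · exact key z hz1 hlow
        · exact key _ (by rw [norm_inv, hz1, inv_one]) hlow'
    _ = _ := by field_simp; norm_num

theorem fourierCoeff_fejerAverage {u : UnitAddCircle → ℝ} (hu : Measurable u) {B : ℝ}
    (hB : ∀ x, |u x| ≤ B) (ω : UnitAddCircle) (M : ℕ) (k : ℤ) :
    fourierCoeff (fun x => (fejerAverage u ω M x : ℂ)) k =
      fejerMultiplier ω M k * fourierCoeff (fun x => (u x : ℂ)) k := by
  have hcast : ∀ x, (fejerAverage u ω M x : ℂ) = ∑ m ∈ Finset.Ioo (-(M : ℤ)) (M : ℤ),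
      ((((M : ℝ) - |(m : ℝ)|) / (M : ℝ) ^ 2 : ℝ) : ℂ) * (u (x + m • ω) : ℂ) := by
    intro x; rw [fejerAverage, Complex.ofReal_sum]; simp only [Complex.ofReal_mul]
  simp only [hcast]
  rw [fourierCoeff_eq_integral_volume]
  simp only [Finset.mul_sum]
  rw [integral_finsetSum, fejerMultiplier, Finset.sum_mul]
  · refine Finset.sum_congr rfl fun m _ => ?_
    rw [mul_assoc, ← fourierCoeff_comp_add_right (fun x => (u x : ℂ)),
      fourierCoeff_eq_integral_volume, ← integral_const_mul]
    congr 1; ext x; ring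
  · intro m _
    refine integrable_of_measurable_bounded
      (C := ‖((((M : ℝ) - |(m : ℝ)|) / (M : ℝ) ^ 2 : ℝ) : ℂ)‖ * B) ?_ fun x => ?_
    · have := (hu.comp (measurable_add_const (m • ω)))
      have h2 : Measurable fun x : UnitAddCircle => (fourier (-k) x : ℂ) :=
        (fourier (-k)).continuous.measurable
      exact h2.mul (measurable_const.mul (Complex.measurable_ofReal.comp this))
    · rw [norm_mul, norm_mul, norm_fourier_apply, one_mul]
      gcongr
      rw [Complex.norm_real]; exact hB _

/-! ### Deviations of the Fejér averages on large scales -/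

theorem fejerMultiplier_zero (ω : UnitAddCircle) {M : ℕ} (hM : 1 ≤ M) :
    fejerMultiplier ω M 0 = 1 := by
  have hM' : (M : ℂ) ≠ 0 := by exact_mod_cast (by omega : M ≠ 0)
  rw [fejerMultiplier_eq ω hM, fourier_zero]
  simp only [inv_one, one_pow, Finset.sum_const, Finset.card_range, nsmul_eq_mul, mul_one]
  field_simp

/-- Two indices of one block with `‖k • ω‖ < δ/2` would differ by a nonzero `j`, `|j| ≤ R`, with `‖j
• ω‖ < δ`. So at most one index is resonant and contributes at most 1; each of the others
contributes at most `1/(Mδ)²`. -/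
theorem sum_Ico_norm_fejerMultiplier_le (ω : UnitAddCircle) {M R : ℕ} (hM : 1 ≤ M) {δ : ℝ}
    (hδ : 0 < δ) (hsep : ∀ k : ℤ, 0 < |k| → |k| ≤ R → δ ≤ ‖k • ω‖) (a : ℤ) :
    ∑ k ∈ Finset.Ico a (a + R), ‖fejerMultiplier ω M k‖ ≤ 1 + R / (M * δ) ^ 2 := by
  classical
  have hM' : (0 : ℝ) < M := by exact_mod_cast hM
  rw [← Finset.sum_filter_add_sum_filter_not _ (fun k : ℤ => ‖k • ω‖ < δ / 2)]
  refine add_le_add ?_ ?_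
  · have hcard : (Finset.filter (fun k : ℤ => ‖k • ω‖ < δ / 2) (Finset.Ico a (a + R))).card ≤ 1 := by
      rw [Finset.card_le_one]
      intro x hx y hy
      simp only [Finset.mem_filter, Finset.mem_Ico] at hx hy
      by_contra hne
      have h1 : 0 < |x - y| := abs_pos.2 (sub_ne_zero.2 hne)
      have h2 : |x - y| ≤ R := by rw [abs_le]; omega
      have h3 := hsep _ h1 h2
      rw [sub_zsmul, ← sub_eq_add_neg] at h3
      have h4 := norm_sub_le (x • ω) (y • ω)
      linarith [hx.2, hy.2]
    calc _ ≤ ∑ k ∈ Finset.filter (fun k : ℤ => ‖k • ω‖ < δ / 2) (Finset.Ico a (a + R)), (1 : ℝ) :=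
          Finset.sum_le_sum fun k _ => norm_fejerMultiplier_le_one ω hM k
      _ ≤ 1 := by
          rw [Finset.sum_const, nsmul_eq_mul, mul_one]; exact_mod_cast hcard
  · calc _ ≤ ∑ k ∈ Finset.filter (fun k : ℤ => ¬ ‖k • ω‖ < δ / 2) (Finset.Ico a (a + R)),
            1 / (M * δ) ^ 2 := by
          refine Finset.sum_le_sum fun k hk => ?_
          have h := norm_fejerMultiplier_le ω hM k (half_pos hδ)
            (not_lt.1 (Finset.mem_filter.1 hk).2)
          refine h.trans (le_of_eq ?_)
          field_simp
          norm_num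
      _ ≤ ∑ k ∈ Finset.Ico a (a + R), 1 / (M * δ) ^ 2 :=
          Finset.sum_le_sum_of_subset_of_nonneg (Finset.filter_subset _ _)
            fun _ _ _ => by positivity
      _ = _ := by simp; ring

/-- Cut `[1, ∞)` into blocks of length `R`. On the block after `(N+1)R` the weight `1/k` is at most
`1/((N+1)R)`, and these bounds add up to a harmonic sum. On the first block the weight gains
nothing, so the factor `1/R` has to come from the pointwise bound `hfirst`. -/
theorem sum_Icc_div_le_of_block_sum_le {d : ℕ → ℝ} (hd : ∀ k, 0 ≤ d k) {R : ℕ} (hR : 1 ≤ R)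
    {T : ℝ} (hblock : ∀ a : ℕ, ∑ k ∈ Finset.Ico a (a + R), d k ≤ T)
    (hfirst : ∀ k, 1 ≤ k → k ≤ R → d k ≤ T / (R : ℝ) ^ 2) (K : ℕ) :
    ∑ k ∈ Finset.Icc 1 K, d k / k ≤ T / R * (2 + Real.log K) := by
  have hR' : (0 : ℝ) < R := by exact_mod_cast hR
  have hT : 0 ≤ T := (Finset.sum_nonneg fun k _ => hd k).trans (hblock 0)
  have hN : ∀ N : ℕ, ∑ k ∈ Finset.Ico 1 (1 + (N + 1) * R), d k / k ≤
      T / R * (1 + ((harmonic N : ℚ) : ℝ)) := by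
    intro N
    induction N with
    | zero =>
      calc _ ≤ ∑ k ∈ Finset.Ico 1 (1 + (0 + 1) * R), T / (R : ℝ) ^ 2 := by
            refine Finset.sum_le_sum fun k hk => ?_
            rw [Finset.mem_Ico] at hk
            have hk1 : (1 : ℝ) ≤ k := by exact_mod_cast hk.1
            exact (div_le_self (hd k) hk1).trans (hfirst k hk.1 (by omega))
        _ = T / R * (1 + ((harmonic 0 : ℚ) : ℝ)) := by
            simp
            field_simp
    | succ N ih =>
      have hsplit : 1 + (N + 1 + 1) * R = 1 + (N + 1) * R + R := by ring
      rw [hsplit, ← Finset.sum_Ico_consecutive _ (by omega : 1 ≤ 1 + (N + 1) * R)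
        (by omega : 1 + (N + 1) * R ≤ 1 + (N + 1) * R + R)]
      have h2 : ∑ k ∈ Finset.Ico (1 + (N + 1) * R) (1 + (N + 1) * R + R), d k / k ≤
          T / R * ((N : ℝ) + 1)⁻¹ := by
        calc _ ≤ ∑ k ∈ Finset.Ico (1 + (N + 1) * R) (1 + (N + 1) * R + R),
              d k / ((N + 1) * R) := by
              refine Finset.sum_le_sum fun k hk => ?_
              have hk1 : ((N : ℝ) + 1) * R ≤ k := by
                exact_mod_cast (by have := (Finset.mem_Ico.1 hk).1; omega : (N + 1) * R ≤ k)
              exact div_le_div_of_nonneg_left (hd k) (by positivity) hk1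
          _ ≤ T / ((N + 1) * R) := by
              rw [← Finset.sum_div]
              gcongr
              exact hblock _
          _ = _ := by field_simp
      rw [harmonic_succ]
      push_cast
      linarith
  calc _ ≤ ∑ k ∈ Finset.Ico 1 (1 + (K + 1) * R), d k / k := by
        refine Finset.sum_le_sum_of_subset_of_nonneg (fun k hk => ?_)
          fun k _ _ => div_nonneg (hd k) (Nat.cast_nonneg k)
        rw [Finset.mem_Icc] at hk
        rw [Finset.mem_Ico]
        refine ⟨hk.1, ?_⟩
        nlinarith
    _ ≤ _ := hN K
    _ ≤ _ := by
        have := harmonic_le_one_add_log K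
        exact mul_le_mul_of_nonneg_left (by linarith) (by positivity)

theorem sum_norm_fejerMultiplier_div_le (ω : UnitAddCircle) {M R : ℕ} (hM : 1 ≤ M) (hR : 1 ≤ R)
    (K : ℕ) {δ T : ℝ} (hδ : 0 < δ) (hsep : ∀ k : ℤ, 0 < |k| → |k| ≤ R → δ ≤ ‖k • ω‖)
    (hT : 1 + (R : ℝ) ^ 2 / (M * δ) ^ 2 ≤ T) :
    ∑ k ∈ (Finset.Icc (-(K : ℤ)) K).erase 0, ‖fejerMultiplier ω M k‖ / |(k : ℝ)| ≤
      2 * (T / R * (2 + Real.log K)) := by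
  classical
  have hM' : (0 : ℝ) < M := by exact_mod_cast hM
  have hR' : (1 : ℝ) ≤ R := by exact_mod_cast hR
  -- `T` serves twice: it bounds every block sum, and `T/R²` bounds each single term with `0 < |k| ≤
  -- R`.
  have hT1 : 1 + R / (M * δ) ^ 2 ≤ T := by
    refine le_trans ?_ hT
    gcongr
    nlinarith
  have hfirst : ∀ k : ℤ, 0 < |k| → |k| ≤ R → ‖fejerMultiplier ω M k‖ ≤ T / (R : ℝ) ^ 2 := by
    intro k hk0 hkR
    refine (norm_fejerMultiplier_le ω hM k hδ (hsep k hk0 hkR)).trans ?_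
    have h0 : (R : ℝ) ^ 2 / (M * δ) ^ 2 ≤ T := by linarith
    rw [le_div_iff₀ (by positivity)]
    refine le_trans ?_ h0
    rw [div_mul_eq_mul_div, one_mul, div_le_div_iff₀ (by positivity) (by positivity)]
    have : 0 ≤ (R : ℝ) ^ 2 * (M * δ) ^ 2 := by positivity
    nlinarith
  have hsub : (Finset.Icc (-(K : ℤ)) K).erase 0 ⊆
      (Finset.Icc 1 K).image (fun k : ℕ => (k : ℤ)) ∪
        (Finset.Icc 1 K).image (fun k : ℕ => -(k : ℤ)) := by
    intro k hk
    simp only [Finset.mem_erase, Finset.mem_Icc, Finset.mem_union, Finset.mem_image] at hk ⊢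
    rcases lt_or_gt_of_ne hk.1 with h | h
    · exact Or.inr ⟨k.natAbs, by omega, by omega⟩
    · exact Or.inl ⟨k.natAbs, by omega, by omega⟩
  have hpos : ∑ k ∈ Finset.Icc 1 K, ‖fejerMultiplier ω M (k : ℤ)‖ / (k : ℝ) ≤
      T / R * (2 + Real.log K) := by
    refine sum_Icc_div_le_of_block_sum_le (fun _ => norm_nonneg _) hR (fun a => ?_)
      (fun k h1 h2 => hfirst k (by positivity) (by simpa using h2)) K
    refine le_trans (le_of_eq ?_)
      ((sum_Ico_norm_fejerMultiplier_le ω hM hδ hsep (a : ℤ)).trans hT1)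
    refine Finset.sum_bij (fun k _ => (k : ℤ)) ?_ ?_ ?_ ?_
    · intro k hk; simp only [Finset.mem_Ico] at hk ⊢; omega
    · intro x _ y _ h; exact_mod_cast h
    · intro y hy
      simp only [Finset.mem_Ico] at hy
      exact ⟨y.toNat, by simp only [Finset.mem_Ico]; omega, by omega⟩
    · intro _ _; rfl
  have hneg : ∑ k ∈ Finset.Icc 1 K, ‖fejerMultiplier ω M (-(k : ℤ))‖ / (k : ℝ) ≤
      T / R * (2 + Real.log K) := by
    refine sum_Icc_div_le_of_block_sum_le (fun _ => norm_nonneg _) hR (fun a => ?_)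
      (fun k h1 h2 => hfirst (-k) (by rw [abs_neg]; positivity) (by simpa using h2)) K
    -- Negation carries `[a, a+R)` onto the half-open block that starts at `-a - R + 1`.
    refine le_trans (le_of_eq ?_)
      ((sum_Ico_norm_fejerMultiplier_le ω hM hδ hsep (-(a : ℤ) - R + 1)).trans hT1)
    refine Finset.sum_bij (fun k _ => -(k : ℤ)) ?_ ?_ ?_ ?_
    · intro k hk; simp only [Finset.mem_Ico] at hk ⊢; omega
    · intro x _ y _ h; simpa using h
    · intro y hy
      simp only [Finset.mem_Ico] at hy
      exact ⟨(-y).toNat, by simp only [Finset.mem_Ico]; omega, by omega⟩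
    · intro _ _; rfl
  calc _ ≤ ∑ k ∈ (Finset.Icc 1 K).image (fun k : ℕ => (k : ℤ)) ∪
        (Finset.Icc 1 K).image (fun k : ℕ => -(k : ℤ)), ‖fejerMultiplier ω M k‖ / |(k : ℝ)| :=
        Finset.sum_le_sum_of_subset_of_nonneg hsub fun _ _ _ => by positivity
    _ ≤ ∑ k ∈ (Finset.Icc 1 K).image (fun k : ℕ => (k : ℤ)), ‖fejerMultiplier ω M k‖ / |(k : ℝ)| +
        ∑ k ∈ (Finset.Icc 1 K).image (fun k : ℕ => -(k : ℤ)),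
          ‖fejerMultiplier ω M k‖ / |(k : ℝ)| := by
        rw [← Finset.sum_union_inter]
        exact le_add_of_nonneg_right (Finset.sum_nonneg fun _ _ => by positivity)
    _ ≤ _ := by
        rw [Finset.sum_image (by intro x _ y _ h; simpa using h),
          Finset.sum_image (by intro x _ y _ h; simpa using h), two_mul]
        refine add_le_add ?_ ?_
        · simpa using hpos
        · simpa using hneg

theorem measure_lt_norm_le_of_integral_sq_le {g : UnitAddCircle → ℂ} (hg : Measurable g) {C V l : ℝ}
    (hC : ∀ x, ‖g x‖ ≤ C) (hV : ∫ x : UnitAddCircle, ‖g x‖ ^ 2 ≤ V) (hl : 0 < l) :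
    volume {x : UnitAddCircle | l < ‖g x‖} ≤ ENNReal.ofReal (V / l ^ 2) := by
  have hint : Integrable (fun x : UnitAddCircle => ‖g x‖ ^ 2) volume :=
    integrable_of_measurable_bounded (C := C ^ 2) (hg.norm.pow_const 2) fun x => by
      rw [norm_pow, norm_norm]; gcongr; exact hC x
  have h := mul_meas_ge_le_integral_of_nonneg (μ := volume)
    (f := fun x : UnitAddCircle => ‖g x‖ ^ 2)
    (Filter.Eventually.of_forall fun x => by positivity) hint (l ^ 2)
  have h2 : volume.real {x : UnitAddCircle | l ^ 2 ≤ ‖g x‖ ^ 2} ≤ V / l ^ 2 := by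
    rw [le_div_iff₀ (by positivity), mul_comm]; exact h.trans hV
  calc _ ≤ volume {x : UnitAddCircle | l ^ 2 ≤ ‖g x‖ ^ 2} :=
        measure_mono fun x (hx : l < ‖g x‖) => by
          show l ^ 2 ≤ ‖g x‖ ^ 2
          gcongr
    _ = ENNReal.ofReal (volume.real {x : UnitAddCircle | l ^ 2 ≤ ‖g x‖ ^ 2}) := by
        rw [Measure.real, ENNReal.ofReal_toReal (measure_ne_top _ _)]
    _ ≤ _ := ENNReal.ofReal_le_ofReal h2

theorem measurable_fejerAverage {u : UnitAddCircle → ℝ} (hu : Measurable u) (ω : UnitAddCircle)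
    (M : ℕ) : Measurable (fejerAverage u ω M) := by
  unfold fejerAverage
  exact Finset.measurable_sum _ fun m _ =>
    measurable_const.mul (hu.comp (measurable_add_const (m • ω)))

theorem abs_fejerAverage_le {u : UnitAddCircle → ℝ} {B : ℝ} (hB : ∀ x, |u x| ≤ B)
    (ω : UnitAddCircle) {M : ℕ} (hM : 1 ≤ M) (x : UnitAddCircle) :
    |fejerAverage u ω M x| ≤ B := by
  have hw : ∑ m ∈ Finset.Ioo (-(M : ℤ)) (M : ℤ), ((M : ℝ) - |(m : ℝ)|) / (M : ℝ) ^ 2 = 1 := by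
    have h := fejerMultiplier_zero ω hM
    rw [fejerMultiplier] at h
    simp only [fourier_zero, mul_one] at h
    exact_mod_cast h
  unfold fejerAverage
  calc _ ≤ ∑ m ∈ Finset.Ioo (-(M : ℤ)) (M : ℤ),
        |((M : ℝ) - |(m : ℝ)|) / (M : ℝ) ^ 2 * u (x + m • ω)| := Finset.abs_sum_le_sum_abs _ _
    _ ≤ ∑ m ∈ Finset.Ioo (-(M : ℤ)) (M : ℤ), ((M : ℝ) - |(m : ℝ)|) / (M : ℝ) ^ 2 * B := by
        refine Finset.sum_le_sum fun m hm => ?_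
        rw [Finset.mem_Ioo] at hm
        have h0 : |(m : ℝ)| ≤ M := by
          rw [abs_le]; constructor
          · exact_mod_cast hm.1.le
          · exact_mod_cast hm.2.le
        have h1 : 0 ≤ ((M : ℝ) - |(m : ℝ)|) / (M : ℝ) ^ 2 :=
          div_nonneg (sub_nonneg.2 h0) (by positivity)
        rw [abs_mul, abs_of_nonneg h1]
        exact mul_le_mul_of_nonneg_left (hB _) h1
    _ = B := by rw [← Finset.sum_mul, hw, one_mul]

/-- The deviation is `P + g`, where `P` collects the frequencies `0 < |k| ≤ K` and `g` the rest.
`hmain` makes `P` at most `l/2` everywhere, so a deviation above `l` forces `|g| > l/2`, which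
Parseval and Chebyshev make rare. -/
theorem measure_fejerAverage_deviation_le {u : UnitAddCircle → ℝ} (hu : Measurable u) {B E : ℝ}
    (hB : ∀ x, |u x| ≤ B)
    (hE : ∀ S : Finset ℤ, ∑ k ∈ S, |(k : ℝ)| * ‖fourierCoeff (fun x => (u x : ℂ)) k‖ ^ 2 ≤ E)
    (ω : UnitAddCircle) {M R K : ℕ} (hM : 1 ≤ M) (hR : 1 ≤ R) (hK : 1 ≤ K) {δ T l : ℝ}
    (hδ : 0 < δ) (hsep : ∀ k : ℤ, 0 < |k| → |k| ≤ R → δ ≤ ‖k • ω‖)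
    (hT : 1 + (R : ℝ) ^ 2 / (M * δ) ^ 2 ≤ T) (hl : 0 < l)
    (hmain : E * (2 * (T / R * (2 + Real.log K))) ≤ (l / 2) ^ 2) :
    volume {x : UnitAddCircle | l < |fejerAverage u ω M x - ∫ y : UnitAddCircle, u y|} ≤
      ENNReal.ofReal (4 * E / (K * l ^ 2)) := by
  classical
  set uh : ℤ → ℂ := fourierCoeff (fun x => (u x : ℂ)) with huh
  set D : ℤ → ℂ := fejerMultiplier ω M with hD
  set S : Finset ℤ := (Finset.Icc (-(K : ℤ)) K).erase 0 with hS
  have hK' : (0 : ℝ) < K := by exact_mod_cast hK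
  have hE0 : 0 ≤ E := by simpa using hE ∅
  set P : UnitAddCircle → ℂ := fun x => ∑ k ∈ S, (uh k * D k) * fourier k x with hP
  have hPle : ∀ x, ‖P x‖ ≤ l / 2 := by
    intro x
    -- The weight `√|k|` is inserted so that Cauchy–Schwarz yields the energy of `u` as one factor.
    have h1 : ‖P x‖ ≤ ∑ k ∈ S, (√|(k : ℝ)| * ‖uh k‖) * (‖D k‖ / √|(k : ℝ)|) := by
      refine (norm_sum_le _ _).trans (Finset.sum_le_sum fun k hk => ?_)
      have hk0 : (k : ℝ) ≠ 0 := by exact_mod_cast (Finset.mem_erase.1 hk).1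
      have hk1 : 0 < √|(k : ℝ)| := Real.sqrt_pos.2 (abs_pos.2 hk0)
      rw [norm_mul, norm_mul, norm_fourier_apply, mul_one]
      apply le_of_eq
      field_simp
    have h2 := Finset.sum_mul_sq_le_sq_mul_sq S (fun k : ℤ => √|(k : ℝ)| * ‖uh k‖)
      (fun k : ℤ => ‖D k‖ / √|(k : ℝ)|)
    have h3 : ∑ k ∈ S, (√|(k : ℝ)| * ‖uh k‖) ^ 2 ≤ E := by
      refine le_trans (le_of_eq (Finset.sum_congr rfl fun k _ => ?_)) (hE S)
      rw [mul_pow, Real.sq_sqrt (abs_nonneg _)]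
    -- Since `‖D k‖ ≤ 1`, its square is bounded by its first power.
    have h4 : ∑ k ∈ S, (‖D k‖ / √|(k : ℝ)|) ^ 2 ≤ 2 * (T / R * (2 + Real.log K)) := by
      refine le_trans (Finset.sum_le_sum fun k _ => ?_)
        (sum_norm_fejerMultiplier_div_le ω hM hR K hδ hsep hT)
      rw [div_pow, Real.sq_sqrt (abs_nonneg _)]
      gcongr
      have := norm_fejerMultiplier_le_one ω hM k
      nlinarith [norm_nonneg (fejerMultiplier ω M k)]
    have h5 : ‖P x‖ ^ 2 ≤ (l / 2) ^ 2 := by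
      calc ‖P x‖ ^ 2 ≤ (∑ k ∈ S, (√|(k : ℝ)| * ‖uh k‖) * (‖D k‖ / √|(k : ℝ)|)) ^ 2 := by
            gcongr
        _ ≤ _ := h2
        _ ≤ E * (2 * (T / R * (2 + Real.log K))) :=
            mul_le_mul h3 h4 (Finset.sum_nonneg fun _ _ => by positivity) hE0
        _ ≤ _ := hmain
    exact (pow_le_pow_iff_left₀ (norm_nonneg _) (by positivity) two_ne_zero).1 h5
  set a : ℝ := ∫ y : UnitAddCircle, u y with ha
  have hab : uh 0 = (a : ℂ) := by
    rw [huh, fourierCoeff_eq_integral_volume]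
    simp only [neg_zero, fourier_zero, one_mul, ha]
    exact integral_ofReal
  set g : UnitAddCircle → ℂ := fun x => (fejerAverage u ω M x : ℂ) - a - P x with hg
  have hF : Measurable (fun x => (fejerAverage u ω M x : ℂ)) :=
    Complex.measurable_ofReal.comp (measurable_fejerAverage hu ω M)
  have hPm : Measurable P := Finset.measurable_sum _ fun k _ =>
    measurable_const.mul (fourier k).continuous.measurable
  have hgm : Measurable g := (hF.sub measurable_const).sub hPm
  have hgb : ∀ x, ‖g x‖ ≤ B + |a| + l / 2 := by
    intro x
    refine (norm_sub_le _ _).trans (add_le_add ((norm_sub_le _ _).trans (add_le_add ?_ ?_)) (hPle x))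
    · rw [Complex.norm_real]; exact abs_fejerAverage_le hB ω hM x
    · rw [Complex.norm_real]; rfl
  have hcoeff : ∀ k : ℤ, fourierCoeff g k = if k ∈ insert 0 S then 0 else D k * uh k := by
    intro k
    have hPk : fourierCoeff P k = if k ∈ S then uh k * D k else 0 := by
      have : P = ∑ j ∈ S, (fun x => (uh j * D j) * fourier j x) := by
        ext x; simp [hP]
      rw [this, fourierCoeff.sum]
      · simp only [Finset.sum_apply]
        have : ∀ j ∈ S, fourierCoeff (fun x : UnitAddCircle => (uh j * D j) * fourier j x) k =
            if k = j then uh j * D j else 0 := by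
          intro j _
          rw [fourierCoeff.const_mul, fourierCoeff_fourier, Pi.single_apply, mul_ite, mul_one,
            mul_zero]
        rw [Finset.sum_congr rfl this, Finset.sum_ite_eq]
      · intro j _
        exact (continuous_const.mul (fourier j).continuous).integrable_of_hasCompactSupport
          (HasCompactSupport.of_compactSpace _)
    have hck : fourierCoeff (fun _ : UnitAddCircle => (a : ℂ)) k = if k = 0 then (a : ℂ) else 0 := by
      have := fourierCoeff.const_mul (fun x : UnitAddCircle => fourier 0 x) (a : ℂ) k
      simp only [fourier_zero, mul_one] at this
      rw [this]
      have h0 := fourierCoeff_fourier (T := 1) 0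
      have h1 : (fun _ : UnitAddCircle => (1 : ℂ)) = (fourier 0 : C(UnitAddCircle, ℂ)) := by
        ext x; simp
      rw [h1, h0, Pi.single_apply, mul_ite, mul_one, mul_zero]
    have hint : ∀ {f : UnitAddCircle → ℂ} (_ : Measurable f) {C : ℝ} (_ : ∀ x, ‖f x‖ ≤ C),
        Integrable (fun x => fourier (-k) x * f x) volume := fun {f} hf {C} hC =>
      integrable_of_measurable_bounded (C := C)
        ((fourier (-k)).continuous.measurable.mul hf) fun x => by
          rw [norm_mul, norm_fourier_apply, one_mul]; exact hC x
    have hsplit : fourierCoeff g k = fourierCoeff (fun x => (fejerAverage u ω M x : ℂ)) k -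
        fourierCoeff (fun _ : UnitAddCircle => (a : ℂ)) k - fourierCoeff P k := by
      simp only [fourierCoeff_eq_integral_volume]
      rw [← integral_sub, ← integral_sub]
      · congr 1; ext x; simp only [hg]; ring
      · refine (hint hF (C := B) fun x => ?_).sub (hint measurable_const (C := |a|) fun x => ?_)
        · rw [Complex.norm_real]; exact abs_fejerAverage_le hB ω hM x
        · rw [Complex.norm_real]; rfl
      · exact hint hPm hPle
      · exact hint hF (C := B) fun x => by
          rw [Complex.norm_real]; exact abs_fejerAverage_le hB ω hM x
      · exact hint measurable_const (C := |a|) fun x => by rw [Complex.norm_real]; rfl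
    rw [hsplit, hPk, hck, fourierCoeff_fejerAverage hu hB, ← hD, ← huh]
    have h0S : (0 : ℤ) ∉ S := by simp [hS]
    by_cases hk : k = 0
    · subst hk
      simp only [h0S, Finset.mem_insert, true_or, if_true, if_false, hab]
      rw [hD, fejerMultiplier_zero ω hM]; ring
    · by_cases hkS : k ∈ S
      · simp [hk, hkS]; ring
      · simp [hk, hkS]
  have hV : ∫ x : UnitAddCircle, ‖g x‖ ^ 2 ≤ E / K := by
    refine hasSum_le_of_sum_le (hasSum_sq_fourierCoeff_of_bounded hgm hgb) fun F => ?_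
    rw [le_div_iff₀ hK', Finset.sum_mul]
    refine (Finset.sum_le_sum fun k _ => ?_).trans (hE F)
    rw [hcoeff]
    split_ifs with hk
    · simp; positivity
    · rw [norm_mul, mul_pow, mul_comm]
      have hkK : (K : ℝ) ≤ |(k : ℝ)| := by
        have : (K : ℤ) ≤ |k| := by
          simp only [hS, Finset.mem_insert, Finset.mem_erase, Finset.mem_Icc] at hk
          rw [le_abs]; omega
        exact_mod_cast this
      have hD1 : ‖D k‖ ^ 2 ≤ 1 := pow_le_one₀ (norm_nonneg _) (norm_fejerMultiplier_le_one ω hM k)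
      calc (K : ℝ) * (‖D k‖ ^ 2 * ‖uh k‖ ^ 2) ≤ |(k : ℝ)| * (1 * ‖uh k‖ ^ 2) := by gcongr
        _ = _ := by rw [one_mul]
  calc _ ≤ volume {x : UnitAddCircle | l / 2 < ‖g x‖} := by
        refine measure_mono fun x (hx : l < |fejerAverage u ω M x - a|) => ?_
        have h1 : (((fejerAverage u ω M x - a : ℝ)) : ℂ) = g x + P x := by
          simp only [hg]; push_cast; ring
        have h2 : |fejerAverage u ω M x - a| ≤ ‖g x‖ + ‖P x‖ := by
          rw [← Real.norm_eq_abs, ← Complex.norm_real, h1]; exact norm_add_le _ _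
        show l / 2 < ‖g x‖
        linarith [hPle x]
    _ ≤ _ := measure_lt_norm_le_of_integral_sq_le hgm hgb hV (half_pos hl)
    _ = _ := by congr 1; field_simp; ring

/-- Put `X = M^σ`, `R = ⌊X⁴⌋`, `K = ⌈e^X⌉`, `l = X⁻¹`. The value of `σ` makes `X⁴ = M^{1/(1+A)}`,
hence `R^{1+A} ≤ M`, and with `δ = c R^{-A}` this gives `Mδ ≥ cR`, so `T = 1 + 1/c²` is admissible.
The uniform part then has square of order `X/X⁴`, below `l² = X⁻²` up to constants once `X` is
large. -/
theorem exists_large_scale_fejerAverage_deviation_lt {A : ℝ} (hA : 0 ≤ A) {c : ℝ} (hc : 0 < c)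
    (E : ℝ) {σ : ℝ} (hσ : σ = 1 / (4 * (1 + A))) :
    ∃ M₀ : ℕ, ∀ (u : UnitAddCircle → ℝ) (B : ℝ), Measurable u → (∀ x, |u x| ≤ B) →
      (∀ S : Finset ℤ, ∑ k ∈ S, |(k : ℝ)| * ‖fourierCoeff (fun x => (u x : ℂ)) k‖ ^ 2 ≤ E) →
      ∀ (ω : UnitAddCircle) (M : ℕ), 1 ≤ M → M₀ ≤ M →
        (∀ k : ℤ, 0 < |k| → |k| ≤ (M : ℤ) → c * |(k : ℝ)| ^ (-A) < ‖k • ω‖) →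
        volume {x : UnitAddCircle |
            (M : ℝ) ^ (-σ) < |fejerAverage u ω M x - ∫ y : UnitAddCircle, u y|} <
          ENNReal.ofReal (Real.exp (-(1 / 2 * (M : ℝ) ^ σ))) := by
  have hσ0 : 0 < σ := by rw [hσ]; positivity
  set T : ℝ := 1 + 1 / c ^ 2 with hTdef
  have hT0 : 0 < T := by positivity
  -- `ev1` is the low-frequency requirement `hmain` after `2 + log K ≤ 3 + X` and `R ≥ X⁴/2`. `ev2`
  -- is the high-frequency one: half of the exponent is given up to absorb the factor `4EX²`.
  have ev1 : ∀ᶠ X : ℝ in Filter.atTop, 16 * E * T * (3 + X) ≤ X ^ 2 := by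
    filter_upwards [Filter.eventually_ge_atTop (max 3 (2 * |16 * E * T|))] with X hX
    have h3 : 3 ≤ X := (le_max_left _ _).trans hX
    have h4 : 2 * |16 * E * T| ≤ X := (le_max_right _ _).trans hX
    have h5 := le_abs_self (16 * E * T)
    have h6 := abs_nonneg (16 * E * T)
    nlinarith
  have ev2 : ∀ᶠ X : ℝ in Filter.atTop, 4 * E * X ^ 2 * Real.exp (-X) < Real.exp (-(1 / 2 * X)) := by
    have h := ((Real.tendsto_pow_mul_exp_neg_atTop_nhds_zero 2).comp
      (Filter.tendsto_id.const_mul_atTop (by norm_num : (0 : ℝ) < 1 / 2))).const_mul (16 * E)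
    rw [mul_zero] at h
    filter_upwards [h.eventually (gt_mem_nhds (zero_lt_one' ℝ))] with X hX
    simp only [Function.comp, id] at hX
    have h2 : Real.exp (-X) = Real.exp (-(1 / 2 * X)) * Real.exp (-(1 / 2 * X)) := by
      rw [← Real.exp_add]; congr 1; ring
    rw [h2]
    have hpos := Real.exp_pos (-(1 / 2 * X))
    nlinarith
  have ev3 := (ev1.and (ev2.and (Filter.eventually_ge_atTop 1)))
  have htend : Filter.Tendsto (fun M : ℕ => (M : ℝ) ^ σ) Filter.atTop Filter.atTop :=
    (tendsto_rpow_atTop hσ0).comp tendsto_natCast_atTop_atTop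
  obtain ⟨M₀, hM₀⟩ := Filter.eventually_atTop.1 (htend.eventually ev3)
  refine ⟨M₀, fun u B hu hB hE ω M hM hMM hω => ?_⟩
  obtain ⟨h1, h2, hX1⟩ := hM₀ M hMM
  have hE0 : 0 ≤ E := by simpa using hE ∅
  have hM' : (1 : ℝ) ≤ M := by exact_mod_cast hM
  set X : ℝ := (M : ℝ) ^ σ with hX
  have hX4 : X ^ 4 = (M : ℝ) ^ (1 / (1 + A)) := by
    rw [hX, ← Real.rpow_natCast, ← Real.rpow_mul (by positivity)]
    congr 1
    rw [hσ]; push_cast; field_simp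
  have hr1 : 1 ≤ X ^ 4 := one_le_pow₀ hX1
  set R : ℕ := ⌊X ^ 4⌋₊ with hR
  have hR1 : 1 ≤ R := by rw [hR, Nat.one_le_floor_iff]; exact hr1
  have hR1' : (1 : ℝ) ≤ R := by exact_mod_cast hR1
  have hRle : (R : ℝ) ≤ X ^ 4 := Nat.floor_le (by positivity)
  have hRge : X ^ 4 / 2 ≤ R := by
    have := Nat.lt_floor_add_one (X ^ 4)
    rw [← hR] at this
    linarith
  have hRA : (R : ℝ) ^ (1 + A) ≤ M := by
    calc (R : ℝ) ^ (1 + A) ≤ ((M : ℝ) ^ (1 / (1 + A))) ^ (1 + A) := by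
          rw [← hX4]; exact Real.rpow_le_rpow (by positivity) hRle (by positivity)
      _ = M := by
          rw [← Real.rpow_mul (by positivity), one_div, inv_mul_cancel₀ (by positivity),
            Real.rpow_one]
  have hRM : R ≤ M := by
    have : (R : ℝ) ≤ M := le_trans (by
      conv_lhs => rw [← Real.rpow_one (R : ℝ)]
      exact Real.rpow_le_rpow_of_exponent_le hR1' (by linarith)) hRA
    exact_mod_cast this
  set K : ℕ := ⌈Real.exp X⌉₊ with hK
  have hKge : Real.exp X ≤ K := Nat.le_ceil _
  have hK1 : 1 ≤ K := Nat.one_le_ceil_iff.2 (Real.exp_pos X)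
  have hlogK : Real.log K ≤ X + 1 := by
    rw [Real.log_le_iff_le_exp (by exact_mod_cast hK1)]
    have h3 := Nat.ceil_lt_add_one (Real.exp_pos X).le
    rw [← hK] at h3
    have h4 : (1 : ℝ) ≤ Real.exp X := Real.one_le_exp (by linarith)
    have h5 : (2 : ℝ) ≤ Real.exp 1 := by have := Real.add_one_le_exp (1 : ℝ); linarith
    rw [Real.exp_add]
    nlinarith
  set δ : ℝ := c * (R : ℝ) ^ (-A) with hδ
  have hδ0 : 0 < δ := by positivity
  have hsep : ∀ k : ℤ, 0 < |k| → |k| ≤ R → δ ≤ ‖k • ω‖ := by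
    intro k hk0 hkR
    refine le_trans ?_ (hω k hk0 (hkR.trans (by exact_mod_cast hRM))).le
    have hk1 : (0 : ℝ) < |(k : ℝ)| := by exact_mod_cast hk0
    have hk2 : |(k : ℝ)| ≤ R := by exact_mod_cast hkR
    rw [hδ]
    exact mul_le_mul_of_nonneg_left (Real.rpow_le_rpow_of_nonpos hk1 hk2 (by linarith)) hc.le
  have hMδ : c * R ≤ M * δ := by
    have h3 : (R : ℝ) * R ^ A ≤ M := by
      rw [← Real.rpow_one_add' (by positivity) (by positivity)]; exact hRA
    have h4 : (0 : ℝ) < (R : ℝ) ^ A := by positivity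
    rw [hδ, Real.rpow_neg (by positivity)]
    have h5 : (R : ℝ) ≤ M * ((R : ℝ) ^ A)⁻¹ := by
      rw [← div_eq_mul_inv, le_div_iff₀ h4]; exact h3
    nlinarith
  have hT : 1 + (R : ℝ) ^ 2 / (M * δ) ^ 2 ≤ T := by
    rw [hTdef]
    have h3 : (R : ℝ) ^ 2 / (M * δ) ^ 2 ≤ (R : ℝ) ^ 2 / (c * R) ^ 2 := by gcongr
    have h4 : (R : ℝ) ^ 2 / (c * R) ^ 2 = 1 / c ^ 2 := by field_simp
    linarith
  have hl : (M : ℝ) ^ (-σ) = X⁻¹ := by rw [Real.rpow_neg (by positivity)]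
  have hmain : E * (2 * (T / R * (2 + Real.log K))) ≤ (X⁻¹ / 2) ^ 2 := by
    have h3 : T / R ≤ T / (X ^ 4 / 2) := by gcongr
    calc E * (2 * (T / R * (2 + Real.log K))) ≤ E * (2 * (T / (X ^ 4 / 2) * (3 + X))) := by
          have h0 : 0 ≤ Real.log K := Real.log_natCast_nonneg K
          have h5 : T / R * (2 + Real.log K) ≤ T / (X ^ 4 / 2) * (3 + X) := by
            apply mul_le_mul h3 (by linarith) (by linarith) (by positivity)
          gcongr
      _ = (16 * E * T * (3 + X)) / (4 * X ^ 4) := by field_simp; ring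
      _ ≤ X ^ 2 / (4 * X ^ 4) := by gcongr
      _ = _ := by field_simp; norm_num
  rw [hl]
  refine (measure_fejerAverage_deviation_le hu hB hE ω hM hR1 hK1 hδ0 hsep hT
    (by positivity : 0 < X⁻¹) hmain).trans_lt ?_
  rw [ENNReal.ofReal_lt_ofReal_iff (Real.exp_pos _)]
  refine lt_of_le_of_lt ?_ h2
  rw [Real.exp_neg, inv_pow]
  calc 4 * E / (K * (X ^ 2)⁻¹) ≤ 4 * E / (Real.exp X * (X ^ 2)⁻¹) := by gcongr
    _ = _ := by field_simp

/-! ### A function of finite `H^{1/2}` energy is close to its mean on a set of positive measure -/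

/-- Below the scale `2^j ≈ k` the terms are `2^j`, above it they are `k²/2^j`; both geometric series
are dominated by their terms near `k`. -/
theorem sum_two_pow_mul_min_le {k : ℝ} (hk : 0 ≤ k) (J : ℕ) :
    ∑ j ∈ Finset.range J, (2 : ℝ) ^ j * min (k ^ 2 / ((2 : ℝ) ^ j) ^ 2) 1 ≤ 4 * k := by
  have h1 : ∀ J : ℕ, ∑ j ∈ Finset.range J, (2 : ℝ) ^ j * min (k ^ 2 / ((2 : ℝ) ^ j) ^ 2) 1 ≤
      2 ^ J := by
    intro J
    induction J with
    | zero => simp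
    | succ J ih =>
      rw [Finset.sum_range_succ, pow_succ (2 : ℝ) J]
      have : (2 : ℝ) ^ J * min (k ^ 2 / ((2 : ℝ) ^ J) ^ 2) 1 ≤ 2 ^ J * 1 := by
        gcongr; exact min_le_right _ _
      linarith
  -- The subtracted `2k²/2^J` is exactly the remaining tail `∑_{j ≥ J} k²/2^j`, which makes the
  -- induction close.
  have h2 : ∀ J : ℕ, k ≤ 2 ^ J →
      ∑ j ∈ Finset.range J, (2 : ℝ) ^ j * min (k ^ 2 / ((2 : ℝ) ^ j) ^ 2) 1 ≤
        4 * k - 2 * k ^ 2 / 2 ^ J := by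
    intro J
    induction J with
    | zero =>
      intro h
      simp at h ⊢
      nlinarith
    | succ J ih =>
      intro h
      by_cases hJ : k ≤ 2 ^ J
      · rw [Finset.sum_range_succ]
        have h3 : (2 : ℝ) ^ J * min (k ^ 2 / ((2 : ℝ) ^ J) ^ 2) 1 ≤ k ^ 2 / 2 ^ J := by
          calc _ ≤ (2 : ℝ) ^ J * (k ^ 2 / ((2 : ℝ) ^ J) ^ 2) := by
                gcongr; exact min_le_left _ _
            _ = _ := by field_simp
        have h4 : 2 * k ^ 2 / 2 ^ (J + 1) = k ^ 2 / 2 ^ J := by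
          rw [pow_succ (2 : ℝ) J]; field_simp
        have h5 : 2 * k ^ 2 / 2 ^ J = k ^ 2 / 2 ^ J + k ^ 2 / 2 ^ J := by ring
        have := ih hJ
        linarith
      · have h3 := h1 (J + 1)
        have h4 : 2 * k ^ 2 / 2 ^ (J + 1) ≤ 2 * k := by
          rw [div_le_iff₀ (by positivity)]; nlinarith
        have h5 : (2 : ℝ) ^ (J + 1) = 2 ^ J * 2 := pow_succ _ _
        linarith
  obtain ⟨N, hN⟩ := pow_unbounded_of_one_lt k (by norm_num : (1 : ℝ) < 2)
  have hle : k ≤ 2 ^ (max N J) := hN.le.trans (by gcongr; norm_num; exact le_max_left _ _)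
  refine le_trans (Finset.sum_le_sum_of_subset_of_nonneg
    (Finset.range_mono (le_max_right N J)) fun _ _ _ => by positivity) ((h2 _ hle).trans ?_)
  have : 0 ≤ 2 * k ^ 2 / 2 ^ (max N J) := by positivity
  linarith

/-- Pigeonhole over `J` dyadic scales: by `sum_two_pow_mul_min_le` the quantities for all scales
together are at most `4E`. With `a k = |f̂(k)|²` the inner sum controls the squared `L²` distance
between `f` and its translate by `2^{-j}`, so at some scale that distance is small even after
multiplication by `2^j`. -/
theorem exists_scale_sum_min_le {a : ℤ → ℝ} (ha : ∀ k, 0 ≤ a k) {E : ℝ}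
    (hE : ∀ S : Finset ℤ, ∑ k ∈ S, |(k : ℝ)| * a k ≤ E) {J : ℕ} (hJ : 1 ≤ J) :
    ∃ j < J, Summable (fun k : ℤ => a k * min ((k : ℝ) ^ 2 / ((2 : ℝ) ^ j) ^ 2) 1) ∧
      (2 : ℝ) ^ j * ∑' k : ℤ, a k * min ((k : ℝ) ^ 2 / ((2 : ℝ) ^ j) ^ 2) 1 ≤ 4 * E / J := by
  have hsum : Summable fun k : ℤ => |(k : ℝ)| * a k :=
    summable_of_sum_le (fun k => mul_nonneg (abs_nonneg _) (ha k)) hE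
  have hJ' : (0 : ℝ) < J := by exact_mod_cast hJ
  have hs : ∀ j : ℕ, Summable fun k : ℤ => a k * min ((k : ℝ) ^ 2 / ((2 : ℝ) ^ j) ^ 2) 1 := by
    intro j
    refine Summable.of_nonneg_of_le (fun k => mul_nonneg (ha k) (by positivity)) (fun k => ?_) hsum
    rw [mul_comm]
    refine mul_le_mul_of_nonneg_right ?_ (ha k)
    by_cases hk : k = 0
    · simp [hk]
    · have : (1 : ℝ) ≤ |(k : ℝ)| := by exact_mod_cast Int.one_le_abs hk
      exact (min_le_right _ _).trans this
  by_contra hcon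
  push Not at hcon
  have h1 : ∑ j ∈ Finset.range J, 4 * E / J <
      ∑ j ∈ Finset.range J,
        (2 : ℝ) ^ j * ∑' k : ℤ, a k * min ((k : ℝ) ^ 2 / ((2 : ℝ) ^ j) ^ 2) 1 :=
    Finset.sum_lt_sum_of_nonempty (Finset.nonempty_range_iff.2 (by omega))
      fun j hj => hcon j (Finset.mem_range.1 hj) (hs j)
  have h2 : ∑ j ∈ Finset.range J, 4 * E / J = 4 * E := by
    rw [Finset.sum_const, Finset.card_range, nsmul_eq_mul]; field_simp
  have h3 : ∑ j ∈ Finset.range J,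
      (2 : ℝ) ^ j * ∑' k : ℤ, a k * min ((k : ℝ) ^ 2 / ((2 : ℝ) ^ j) ^ 2) 1 ≤ 4 * E := by
    simp only [← tsum_mul_left]
    rw [← Summable.tsum_finsetSum fun j _ => (hs j).mul_left _]
    calc _ ≤ ∑' k : ℤ, 4 * (|(k : ℝ)| * a k) := by
          refine Summable.tsum_le_tsum (fun k => ?_)
            (summable_sum fun j _ => (hs j).mul_left _) (hsum.mul_left 4)
          have h := sum_two_pow_mul_min_le (abs_nonneg (k : ℝ)) J
          rw [sq_abs] at h
          calc _ = a k * ∑ j ∈ Finset.range J,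
                (2 : ℝ) ^ j * min ((k : ℝ) ^ 2 / ((2 : ℝ) ^ j) ^ 2) 1 := by
                rw [Finset.mul_sum]; exact Finset.sum_congr rfl fun j _ => by ring
            _ ≤ a k * (4 * |(k : ℝ)|) := mul_le_mul_of_nonneg_left h (ha k)
            _ = _ := by ring
      _ ≤ 4 * E := by
          rw [tsum_mul_left]
          exact mul_le_mul_of_nonneg_left (hsum.tsum_le_of_sum_le hE) (by norm_num)
  linarith

/-- Parseval with `|e(kt) - 1|² ≤ min((2πk/N)², 4)`; the constant 40 covers both `4π²` and 4. -/
theorem integral_sq_sub_translate_le {f : UnitAddCircle → ℝ} (hf : Measurable f) {B : ℝ}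
    (hB : ∀ x, |f x| ≤ B) {N s : ℝ} (hN : 0 < N) (hs0 : 0 ≤ s) (hs1 : s ≤ 1)
    (hsum : Summable (fun k : ℤ =>
      ‖fourierCoeff (fun x => (f x : ℂ)) k‖ ^ 2 * min ((k : ℝ) ^ 2 / N ^ 2) 1)) :
    ∫ x : UnitAddCircle, (f (x + ((s / N : ℝ) : UnitAddCircle)) - f x) ^ 2 ≤
      40 * ∑' k : ℤ, ‖fourierCoeff (fun x => (f x : ℂ)) k‖ ^ 2 * min ((k : ℝ) ^ 2 / N ^ 2) 1 := by
  set t : UnitAddCircle := ((s / N : ℝ) : UnitAddCircle) with ht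
  have hfc : Measurable fun x => (f x : ℂ) := Complex.measurable_ofReal.comp hf
  have hft : Measurable fun x => (f (x + t) : ℂ) := hfc.comp (measurable_add_const t)
  have h := hasSum_sq_fourierCoeff_of_bounded (hft.sub hfc) (C := B + B) fun x => by
    refine (norm_sub_le _ _).trans (add_le_add ?_ ?_) <;> rw [Complex.norm_real] <;> exact hB _
  have hint : ∀ k : ℤ, ∀ {g : UnitAddCircle → ℂ} (_ : Measurable g) (_ : ∀ x, ‖g x‖ ≤ B),
      Integrable (fun x => fourier (-k) x * g x) volume := fun k g hg hC =>
    integrable_of_measurable_bounded (C := B)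
      ((fourier (-k)).continuous.measurable.mul hg) fun x => by
        rw [norm_mul, norm_fourier_apply, one_mul]; exact hC x
  have hcoeff : ∀ k, fourierCoeff ((fun x => (f (x + t) : ℂ)) - fun x => (f x : ℂ)) k =
      (fourier k t - 1) * fourierCoeff (fun x => (f x : ℂ)) k := by
    intro k
    rw [sub_mul, one_mul, ← fourierCoeff_comp_add_right (fun x => (f x : ℂ))]
    simp only [fourierCoeff_eq_integral_volume, Pi.sub_apply, mul_sub]
    exact integral_sub (hint k hft fun x => by rw [Complex.norm_real]; exact hB _)
      (hint k hfc fun x => by rw [Complex.norm_real]; exact hB _)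
  have heq : ∫ x : UnitAddCircle, (f (x + t) - f x) ^ 2 =
      ∫ x : UnitAddCircle, ‖((fun x => (f (x + t) : ℂ)) - fun x => (f x : ℂ)) x‖ ^ 2 := by
    congr 1; ext x
    rw [Pi.sub_apply, ← Complex.ofReal_sub, Complex.norm_real, Real.norm_eq_abs, sq_abs]
  rw [heq, ← tsum_mul_left]
  refine hasSum_le (fun k => ?_) h (hsum.mul_left 40).hasSum
  rw [hcoeff, norm_mul, mul_pow]
  have hb : ‖(fourier k t : ℂ) - 1‖ ^ 2 ≤ 40 * min ((k : ℝ) ^ 2 / N ^ 2) 1 := by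
    rw [mul_min_of_nonneg _ _ (by norm_num : (0 : ℝ) ≤ 40)]
    refine le_min ?_ ?_
    · have h1 := norm_fourier_coe_sub_one_le k (s / N)
      have h2 : |s / N| ≤ 1 / N := by
        rw [abs_of_nonneg (by positivity)]; gcongr
      have h3 : ‖(fourier k t : ℂ) - 1‖ ≤ 2 * Real.pi * |(k : ℝ)| * (1 / N) :=
        h1.trans (by gcongr)
      calc _ ≤ (2 * Real.pi * |(k : ℝ)| * (1 / N)) ^ 2 := by gcongr
        _ = 4 * Real.pi ^ 2 * ((k : ℝ) ^ 2 / N ^ 2) := by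
            rw [mul_pow, mul_pow, mul_pow, sq_abs]; ring
        _ ≤ _ := by
            have : Real.pi ^ 2 ≤ 10 := by nlinarith [Real.pi_lt_d2, Real.pi_pos]
            gcongr; linarith
    · have h1 : ‖(fourier k t : ℂ) - 1‖ ≤ 2 := by
        refine (norm_sub_le _ _).trans ?_
        rw [norm_fourier_apply, norm_one]; norm_num
      nlinarith [norm_nonneg ((fourier k t : ℂ) - 1)]
  calc _ ≤ 40 * min ((k : ℝ) ^ 2 / N ^ 2) 1 * ‖fourierCoeff (fun x => (f x : ℂ)) k‖ ^ 2 := by gcongr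
    _ = _ := by ring

theorem integral_abs_sub_translate_nsmul_le {h : UnitAddCircle → ℝ} (hh : Measurable h) {C : ℝ}
    (hC : ∀ x, |h x| ≤ C) (t : UnitAddCircle) (n : ℕ) :
    ∫ x : UnitAddCircle, |h (x + n • t) - h x| ≤ n * ∫ x : UnitAddCircle, |h (x + t) - h x| := by
  have hint : ∀ s r : UnitAddCircle, Integrable (fun x => |h (x + s) - h (x + r)|) volume :=
    fun s r => integrable_of_measurable_bounded (C := C + C)
      (((hh.comp (measurable_add_const s)).sub (hh.comp (measurable_add_const r))).abs) fun x => by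
        rw [Real.norm_eq_abs, abs_abs]
        exact (abs_sub _ _).trans (add_le_add (hC _) (hC _))
  induction n with
  | zero => simp
  | succ n ih =>
    have h1 : ∫ x : UnitAddCircle, |h (x + n • t + t) - h (x + n • t)| =
        ∫ x : UnitAddCircle, |h (x + t) - h x| :=
      integral_add_right_eq_self (fun x => |h (x + t) - h x|) (n • t)
    calc ∫ x : UnitAddCircle, |h (x + (n + 1) • t) - h x| ≤
        ∫ x : UnitAddCircle, (|h (x + n • t + t) - h (x + n • t)| + |h (x + n • t) - h x|) := by
          refine integral_mono ?_ ?_ fun x => ?_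
          · simpa using hint ((n + 1) • t) 0
          · refine Integrable.add ?_ ?_
            · simpa [add_assoc] using hint (n • t + t) (n • t)
            · simpa using hint (n • t) 0
          · show |h (x + (n + 1) • t) - h x| ≤
              |h (x + n • t + t) - h (x + n • t)| + |h (x + n • t) - h x|
            rw [succ_nsmul, ← add_assoc]
            exact abs_sub_le _ _ _
      _ = (∫ x : UnitAddCircle, |h (x + n • t + t) - h (x + n • t)|) +
            ∫ x : UnitAddCircle, |h (x + n • t) - h x| := by
          refine integral_add ?_ ?_
          · simpa [add_assoc] using hint (n • t + t) (n • t)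
          · simpa using hint (n • t) 0
      _ ≤ _ := by rw [h1]; push_cast; linarith

/-- Averaged over all translations `t`, `∫ g(x) h(x+t) dx` equals `∫ g · ∫ h = 0`, while each of
these integrals differs from `∫ g h` by at most `C Q`. -/
theorem integral_mul_le_of_integral_abs_sub_translate_le {g h : UnitAddCircle → ℝ}
    (hg : Measurable g) (hh : Measurable h) {C D Q : ℝ} (hC : ∀ x, |g x| ≤ C)
    (hD : ∀ x, |h x| ≤ D) (hg0 : ∫ x : UnitAddCircle, g x = 0)
    (hQ : ∀ t, ∫ x : UnitAddCircle, |h (x + t) - h x| ≤ Q) :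
    ∫ x : UnitAddCircle, g x * h x ≤ C * Q := by
  have hC0 : 0 ≤ C := (abs_nonneg _).trans (hC 0)
  have hmul : ∀ t : UnitAddCircle, Integrable (fun x => g x * h (x + t)) volume := fun t =>
    integrable_of_measurable_bounded (C := C * D) (hg.mul (hh.comp (measurable_add_const t)))
      fun x => by
        rw [norm_mul]
        exact mul_le_mul (hC _) (hD _) (norm_nonneg _) hC0
  have hprod : Integrable (Function.uncurry fun t x : UnitAddCircle => g x * h (x + t))
      (volume.prod volume) := by
    refine integrable_of_measurable_bounded (C := C * D) ?_ fun x => ?_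
    · exact (hg.comp measurable_snd).mul (hh.comp (measurable_snd.add measurable_fst))
    · rw [Function.uncurry, norm_mul]
      exact mul_le_mul (hC _) (hD _) (norm_nonneg _) hC0
  have hzero : ∫ t : UnitAddCircle, ∫ x : UnitAddCircle, g x * h (x + t) = 0 := by
    rw [integral_integral_swap hprod]
    have : ∀ x : UnitAddCircle, ∫ t : UnitAddCircle, g x * h (x + t) =
        g x * ∫ t : UnitAddCircle, h t := by
      intro x
      rw [integral_const_mul, integral_add_left_eq_self h x]
    simp only [this]
    rw [integral_mul_const, hg0, zero_mul]
  have hpt : ∀ t : UnitAddCircle,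
      (∫ x : UnitAddCircle, g x * h x) - C * Q ≤ ∫ x : UnitAddCircle, g x * h (x + t) := by
    intro t
    have h1 : (∫ x : UnitAddCircle, g x * h x) - ∫ x : UnitAddCircle, g x * h (x + t) ≤
        C * ∫ x : UnitAddCircle, |h (x + t) - h x| := by
      rw [← integral_sub (by simpa using hmul 0) (hmul t), ← integral_const_mul]
      refine integral_mono ((by simpa using hmul 0 : Integrable (fun x => g x * h x)).sub (hmul t))
        (Integrable.const_mul (integrable_of_measurable_bounded (C := D + D)
          ((hh.comp (measurable_add_const t)).sub hh).abs fun x => ?_) C) fun x => ?_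
      · rw [Real.norm_eq_abs, abs_abs]
        exact (abs_sub _ _).trans (add_le_add (hD _) (hD _))
      · show g x * h x - g x * h (x + t) ≤ C * |h (x + t) - h x|
        rw [← mul_sub, abs_sub_comm]
        refine (le_abs_self _).trans ?_
        rw [abs_mul]
        exact mul_le_mul_of_nonneg_right (hC x) (abs_nonneg _)
    have h2 := mul_le_mul_of_nonneg_left (hQ t) hC0
    linarith
  have h3 := integral_mono (μ := (volume : Measure UnitAddCircle))
    (integrable_const ((∫ x : UnitAddCircle, g x * h x) - C * Q)) hprod.integral_prod_left hpt
  have h4 : ∫ t : UnitAddCircle, (∫ x : UnitAddCircle,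
      Function.uncurry (fun t x : UnitAddCircle => g x * h (x + t)) (t, x)) = 0 := hzero
  rw [h4] at h3
  simp only [integral_const, Measure.real, UnitAddCircle.measure_univ, ENNReal.toReal_one,
    one_smul] at h3
  linarith

/-- Suppose the near-mean set `Z` has measure below `δ`. Then `h`, the truncation of `(f - a)/ε` to
`[-1, 1]`, is `±1` off `Z`, and `∫ (f - a) h ≥ ε(1 - δ)`. On the other hand `h` hardly moves under
translation in `L¹`, so the integral is small because `f - a` has mean zero. -/
theorem exists_measure_near_mean_ge (B E : ℝ) {ε : ℝ} (hε : 0 < ε) :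
    ∃ δ : ℝ, 0 < δ ∧ ∀ f : UnitAddCircle → ℝ, Measurable f → (∀ x, |f x| ≤ B) →
      (∀ S : Finset ℤ, ∑ k ∈ S, |(k : ℝ)| * ‖fourierCoeff (fun x => (f x : ℂ)) k‖ ^ 2 ≤ E) →
      δ ≤ volume.real {x : UnitAddCircle | |f x - ∫ y : UnitAddCircle, f y| ≤ ε} := by
  -- `J` is chosen first, to beat the energy; `δ` afterwards, to beat the loss `2^J` from the number
  -- of translation steps.
  obtain ⟨J, hJ⟩ := exists_nat_ge (max 1 (640 * |B| * |E| / ε ^ 3))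
  have hJ1 : (1 : ℝ) ≤ J := (le_max_left _ _).trans hJ
  have hJ2 : 640 * |B| * |E| / ε ^ 3 ≤ J := (le_max_right _ _).trans hJ
  have hJ1' : 1 ≤ J := by exact_mod_cast hJ1
  set δ : ℝ := min (1 / 2) (ε / (64 * (|B| + 1) * 2 ^ J)) with hδ
  have hδ0 : 0 < δ := lt_min (by norm_num) (by positivity)
  refine ⟨δ, hδ0, fun f hf hB hE => ?_⟩
  by_contra hlt
  push Not at hlt
  have hB0 : 0 ≤ B := (abs_nonneg _).trans (hB 0)
  have hE0 : 0 ≤ E := by simpa using hE ∅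
  rw [abs_of_nonneg hB0] at hδ hJ2
  rw [abs_of_nonneg hE0] at hJ2
  set a : ℝ := ∫ y : UnitAddCircle, f y with ha
  set Z : Set UnitAddCircle := {x | |f x - a| ≤ ε} with hZ
  have hfint : Integrable f volume := integrable_of_measurable_bounded hf hB
  have haB : |a| ≤ B := by
    have h := norm_integral_le_of_norm_le_const (μ := (volume : Measure UnitAddCircle))
      (f := f) (C := B) (Filter.Eventually.of_forall hB)
    simpa [Measure.real, UnitAddCircle.measure_univ] using h
  set g : UnitAddCircle → ℝ := fun x => f x - a with hg
  have hgm : Measurable g := hf.sub measurable_const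
  have hgB : ∀ x, |g x| ≤ 2 * B := fun x => (abs_sub _ _).trans (by linarith [hB x])
  have hg0 : ∫ x : UnitAddCircle, g x = 0 := by
    simp only [hg]
    rw [integral_sub hfint (integrable_const _), integral_const, Measure.real,
      UnitAddCircle.measure_univ, ← ha]
    simp
  set h : UnitAddCircle → ℝ := fun x => max (-1) (min 1 (g x / ε)) with hh
  have hhm : Measurable h := measurable_const.max (measurable_const.min (hgm.div_const ε))
  have hh1 : ∀ x, |h x| ≤ 1 := fun x => by
    rw [abs_le]
    exact ⟨le_max_left _ _, max_le (by norm_num) (min_le_left _ _)⟩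
  have hZm : MeasurableSet Z := measurableSet_le hgm.abs measurable_const
  have hlip : ∀ x y, |h x - h y| ≤ |f x - f y| / ε := fun x y => by
    have h1 : |h x - h y| ≤ |min 1 (g x / ε) - min 1 (g y / ε)| := by
      refine (abs_max_sub_max_le_max _ _ _ _).trans ?_
      simp
    have h2 : |min 1 (g x / ε) - min 1 (g y / ε)| ≤ |g x / ε - g y / ε| := by
      refine (abs_min_sub_min_le_max _ _ _ _).trans ?_
      simp
    refine (h1.trans h2).trans (le_of_eq ?_)
    rw [← sub_div, abs_div, abs_of_pos hε]
    simp [hg]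
  have hoff : ∀ x, x ∉ Z → (h x = 1 ∧ ε < g x) ∨ (h x = -1 ∧ g x < -ε) := by
    intro x hx
    have hx' : ε < |g x| := not_le.1 hx
    rcases lt_abs.1 hx' with h1 | h1
    · left
      refine ⟨?_, h1⟩
      have : 1 ≤ g x / ε := by rw [le_div_iff₀ hε]; linarith
      simp only [hh, min_eq_left this]
      norm_num
    · right
      refine ⟨?_, by linarith⟩
      have : g x / ε ≤ -1 := by rw [div_le_iff₀ hε]; linarith
      simp only [hh]
      rw [max_eq_left ((min_le_right _ _).trans this)]
  have hgh : ε * (1 - δ) ≤ ∫ x : UnitAddCircle, g x * h x := by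
    have h1 : ∀ x, ε - Z.indicator (fun _ => ε) x ≤ g x * h x := by
      intro x
      by_cases hx : x ∈ Z
      · rw [Set.indicator_of_mem hx, sub_self]
        rcases le_total 0 (g x) with h0 | h0
        · exact mul_nonneg h0 (le_max_of_le_right (le_min (by norm_num) (by positivity)))
        · refine mul_nonneg_of_nonpos_of_nonpos h0 (max_le (by norm_num)
            ((min_le_right _ _).trans ?_))
          exact div_nonpos_of_nonpos_of_nonneg h0 hε.le
      · rw [Set.indicator_of_notMem hx, sub_zero]
        rcases hoff x hx with ⟨h1, h2⟩ | ⟨h1, h2⟩ <;> rw [h1] <;> linarith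
    have h2 : Integrable (fun x => g x * h x) volume :=
      integrable_of_measurable_bounded (C := 2 * B * 1) (hgm.mul hhm) fun x => by
        rw [norm_mul]; exact mul_le_mul (hgB x) (hh1 x) (norm_nonneg _) (by positivity)
    have h3 : Integrable (Z.indicator fun _ : UnitAddCircle => ε) volume :=
      (integrable_const ε).indicator hZm
    have h4 := integral_mono ((integrable_const ε).sub h3) h2 h1
    have h5 : ∫ x : UnitAddCircle, ((fun _ : UnitAddCircle => ε) - Z.indicator (fun _ => ε)) x =
        ε - volume.real Z * ε := by
      simp only [Pi.sub_apply]
      rw [integral_sub (integrable_const ε) h3, integral_const, integral_indicator_const _ hZm,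
        measureReal_def, UnitAddCircle.measure_univ]
      simp
    rw [h5] at h4
    nlinarith
  obtain ⟨j, hjJ, hsum, hj⟩ := exists_scale_sum_min_le
    (a := fun k => ‖fourierCoeff (fun x => (f x : ℂ)) k‖ ^ 2) (fun k => by positivity) hE hJ1'
  set N : ℝ := (2 : ℝ) ^ j with hN
  have hN0 : 0 < N := by positivity
  have hL : ∀ t : UnitAddCircle, ∫ x : UnitAddCircle, |h (x + t) - h x| ≤
      80 * E / (J * ε ^ 2) + 4 * 2 ^ J * δ := by
    intro t
    -- An arbitrary translation `s` is carried out as `N = 2^j` equal steps `r = s/N`, at the good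
    -- scale `j`.
    obtain ⟨s, ⟨hs0, hs1⟩, rfl⟩ : ∃ s ∈ Set.Ico (0 : ℝ) (0 + 1), ((s : ℝ) : UnitAddCircle) = t := by
      have h := Set.mem_univ t
      rwa [← AddCircle.coe_image_Ico_eq (1 : ℝ) 0] at h
    rw [zero_add] at hs1
    set r : UnitAddCircle := ((s / N : ℝ) : UnitAddCircle) with hr
    have hsr : ((s : ℝ) : UnitAddCircle) = (2 ^ j : ℕ) • r := by
      rw [hr, ← AddCircle.coe_nsmul, nsmul_eq_mul]
      congr 1
      push_cast
      rw [← hN]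
      field_simp
    have hE2 := integral_sq_sub_translate_le hf hB hN0 hs0 hs1.le hsum
    rw [← hr] at hE2
    set G : ℝ := ∑' k : ℤ,
      ‖fourierCoeff (fun x => (f x : ℂ)) k‖ ^ 2 * min ((k : ℝ) ^ 2 / N ^ 2) 1 with hG
    -- The crux: when `x` and `x + r` both avoid `Z`, the increment of `h` is 0 or ±2, so its
    -- absolute value equals half its square. The `L¹` size of a step is thus quadratic in the
    -- increment of `f`, and `N` steps cost `N` times a squared `L²` distance, which is what the
    -- pigeonhole bounds.
    have hpt : ∀ x, |h (x + r) - h x| ≤ 1 / (2 * ε ^ 2) * (f (x + r) - f x) ^ 2 +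
        2 * (Z.indicator (fun _ => 1) x + Z.indicator (fun _ => 1) (x + r)) := by
      intro x
      have hsq : 0 ≤ 1 / (2 * ε ^ 2) * (f (x + r) - f x) ^ 2 := by positivity
      have hi : ∀ y : UnitAddCircle, (0 : ℝ) ≤ Z.indicator (fun _ => 1) y := fun y =>
        Set.indicator_nonneg (fun _ _ => zero_le_one) y
      have h2 : |h (x + r) - h x| ≤ 2 := (abs_sub _ _).trans (by linarith [hh1 x, hh1 (x + r)])
      by_cases hx : x ∈ Z
      · rw [Set.indicator_of_mem hx]; linarith [hi (x + r)]
      by_cases hxr : x + r ∈ Z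
      · rw [Set.indicator_of_mem hxr]; linarith [hi x]
      rw [Set.indicator_of_notMem hx, Set.indicator_of_notMem hxr]
      have h3 : |h (x + r) - h x| = |h (x + r) - h x| ^ 2 / 2 := by
        rcases hoff x hx with ⟨h1, -⟩ | ⟨h1, -⟩ <;>
          rcases hoff _ hxr with ⟨h2, -⟩ | ⟨h2, -⟩ <;> rw [h1, h2] <;> norm_num
      rw [h3]
      have h4 := pow_le_pow_left₀ (abs_nonneg _) (hlip (x + r) x) 2
      rw [div_pow, sq_abs (f _ - _)] at h4
      calc _ ≤ (f (x + r) - f x) ^ 2 / ε ^ 2 / 2 := by gcongr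
        _ = _ := by field_simp; ring
    have hZi : Integrable (Z.indicator fun _ : UnitAddCircle => (1 : ℝ)) volume :=
      (integrable_const 1).indicator hZm
    have hZr : Integrable (fun x => Z.indicator (fun _ : UnitAddCircle => (1 : ℝ)) (x + r)) volume :=
      hZi.comp_add_right r
    have hZv : ∫ x : UnitAddCircle, Z.indicator (fun _ => (1 : ℝ)) x = volume.real Z := by
      rw [integral_indicator_const _ hZm, smul_eq_mul, mul_one]
    have hZv2 : ∫ x : UnitAddCircle, Z.indicator (fun _ => (1 : ℝ)) (x + r) = volume.real Z := by
      rw [integral_add_right_eq_self (fun x => Z.indicator (fun _ => (1 : ℝ)) x) r, hZv]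
    have hfi : Integrable (fun x => 1 / (2 * ε ^ 2) * (f (x + r) - f x) ^ 2) volume := by
      refine Integrable.const_mul (integrable_of_measurable_bounded (C := (2 * B) ^ 2)
        (((hf.comp (measurable_add_const r)).sub hf).pow_const 2) fun x => ?_) _
      rw [norm_pow, Real.norm_eq_abs]
      exact pow_le_pow_left₀ (abs_nonneg _)
        ((abs_sub _ _).trans ((add_le_add (hB (x + r)) (hB x)).trans_eq (two_mul B).symm)) 2
    have hLr : ∫ x : UnitAddCircle, |h (x + r) - h x| ≤ 1 / (2 * ε ^ 2) * (40 * G) + 4 * δ := by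
      calc _ ≤ ∫ x : UnitAddCircle, (1 / (2 * ε ^ 2) * (f (x + r) - f x) ^ 2 +
            2 * (Z.indicator (fun _ => 1) x + Z.indicator (fun _ => 1) (x + r))) := by
            refine integral_mono ?_ (hfi.add ((hZi.add hZr).const_mul 2)) hpt
            refine integrable_of_measurable_bounded (C := 2)
              ((hhm.comp (measurable_add_const r)).sub hhm).abs fun x => ?_
            rw [Real.norm_eq_abs, abs_abs]
            exact (abs_sub _ _).trans ((add_le_add (hh1 (x + r)) (hh1 x)).trans_eq (by norm_num))
        _ = 1 / (2 * ε ^ 2) * (∫ x : UnitAddCircle, (f (x + r) - f x) ^ 2) +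
            2 * (volume.real Z + volume.real Z) := by
            have hadd := integral_add hZi hZr
            rw [hZv, hZv2] at hadd
            rw [← hadd, ← integral_const_mul, ← integral_const_mul]
            exact integral_add hfi ((hZi.add hZr).const_mul 2)
        _ ≤ 1 / (2 * ε ^ 2) * (40 * G) + 4 * δ := by
            have : 1 / (2 * ε ^ 2) * (∫ x : UnitAddCircle, (f (x + r) - f x) ^ 2) ≤
                1 / (2 * ε ^ 2) * (40 * G) := by gcongr
            linarith
    have hLn := integral_abs_sub_translate_nsmul_le hhm hh1 r (2 ^ j)
    rw [← hsr] at hLn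
    refine hLn.trans ?_
    push_cast
    rw [← hN]
    have hN2 : N ≤ 2 ^ J := by rw [hN]; exact pow_le_pow_right₀ (by norm_num) hjJ.le
    calc N * ∫ x : UnitAddCircle, |h (x + r) - h x| ≤
          N * (1 / (2 * ε ^ 2) * (40 * G) + 4 * δ) := by gcongr
      _ = 20 / ε ^ 2 * (N * G) + 4 * N * δ := by field_simp; ring
      _ ≤ 20 / ε ^ 2 * (4 * E / J) + 4 * 2 ^ J * δ := by gcongr
      _ = _ := by field_simp; ring
  have hfin := integral_mul_le_of_integral_abs_sub_translate_le hgm hhm hgB hh1 hg0 hL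
  -- The upper bound totals `ε/4 + ε/8`, against the lower bound `ε(1 - δ) ≥ ε/2`.
  have hk1 : 2 * B * (80 * E / (J * ε ^ 2)) ≤ ε / 4 := by
    have : 640 * B * E ≤ J * ε ^ 3 := by rwa [div_le_iff₀ (by positivity)] at hJ2
    rw [mul_div_assoc', div_le_iff₀ (by positivity)]
    nlinarith
  have hk2 : 2 * B * (4 * 2 ^ J * δ) ≤ ε / 8 := by
    have h1 : δ ≤ ε / (64 * (B + 1) * 2 ^ J) := hδ.le.trans (min_le_right _ _)
    rw [le_div_iff₀ (by positivity)] at h1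
    have h2 : 0 ≤ (2 : ℝ) ^ J * δ := by positivity
    nlinarith
  have hk3 : δ ≤ 1 / 2 := min_le_left _ _
  nlinarith

/-! ### A trace inequality on a rectangle -/

theorem fourier_coe_unitAddCircle_continuous (k : ℤ) :
    Continuous fun x : ℝ => (fourier k (x : UnitAddCircle) : ℂ) :=
  (fourier k).continuous.comp (AddCircle.continuous_mk' 1)

/-- On an interval of length 2 the characters of period 1 are the even modes of period 2, so this is
Bessel's inequality. The constant is `4 · 1/2`, from the normalisation of the coefficients and of
the norm. -/
theorem sum_sq_norm_intervalIntegral_fourier_le {f : ℝ → ℂ} (hf : Continuous f) (S : Finset ℤ) :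
    ∑ k ∈ S, ‖∫ x in (0 : ℝ)..2, fourier (-k) (x : UnitAddCircle) * f x‖ ^ 2 ≤
      2 * ∫ x in (0 : ℝ)..2, ‖f x‖ ^ 2 := by
  have h02 : (0 : ℝ) < 2 := by norm_num
  have hL : MemLp f 2 (volume.restrict (Set.Ioc 0 2)) := by
    obtain ⟨C, hC⟩ := isCompact_Icc.exists_bound_of_continuousOn (s := Set.Icc (0 : ℝ) 2)
      hf.continuousOn
    refine MemLp.of_bound hf.aestronglyMeasurable C ?_
    filter_upwards [ae_restrict_mem measurableSet_Ioc] with x hx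
    exact hC x (Set.Ioc_subset_Icc_self hx)
  have hs := hasSum_sq_fourierCoeffOn h02 hL
  have hk : ∀ k : ℤ, ‖∫ x in (0 : ℝ)..2, fourier (-k) (x : UnitAddCircle) * f x‖ ^ 2 =
      4 * ‖fourierCoeffOn h02 f (2 * k)‖ ^ 2 := by
    intro k
    rw [fourierCoeffOn_eq_integral]
    have : ∀ x : ℝ, (fourier (-(2 * k)) (x : AddCircle ((2 : ℝ) - 0)) : ℂ) • f x =
        fourier (-k) (x : UnitAddCircle) * f x := by
      intro x
      rw [fourier_coe_apply, fourier_coe_apply, smul_eq_mul]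
      congr 2
      push_cast
      ring
    simp only [this]
    rw [norm_smul, mul_pow]
    norm_num
    ring
  simp only [hk]
  rw [← Finset.mul_sum]
  have h1 : ∑ k ∈ S, ‖fourierCoeffOn h02 f (2 * k)‖ ^ 2 ≤
      ((2 : ℝ) - 0)⁻¹ • ∫ x in (0 : ℝ)..2, ‖f x‖ ^ 2 := by
    have := sum_le_hasSum (S.map ⟨fun k : ℤ => 2 * k, fun a b h => by simpa using h⟩)
      (fun _ _ => by positivity) hs
    rw [Finset.sum_map] at this
    exact this
  rw [sub_zero, smul_eq_mul] at h1
  linarith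

theorem hasDerivAt_intervalIntegral_of_continuous {G Gy : ℝ → ℝ → ℂ} (a b : ℝ)
    (hG : ∀ y, Continuous fun x => G x y) (hGy : Continuous (Function.uncurry Gy))
    (hd : ∀ x y, HasDerivAt (fun y => G x y) (Gy x y) y) (y₀ : ℝ) :
    HasDerivAt (fun y => ∫ x in a..b, G x y) (∫ x in a..b, Gy x y₀) y₀ := by
  obtain ⟨C, hC⟩ := (isCompact_uIcc.prod isCompact_Icc).exists_bound_of_continuousOn
    (s := Set.uIcc a b ×ˢ Set.Icc (y₀ - 1) (y₀ + 1)) hGy.continuousOn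
  refine (intervalIntegral.hasDerivAt_integral_of_dominated_loc_of_deriv_le
    (F := fun y x => G x y) (F' := fun y x => Gy x y) (bound := fun _ => C)
    (Icc_mem_nhds (by linarith : y₀ - 1 < y₀) (by linarith : y₀ < y₀ + 1))
    (Filter.Eventually.of_forall fun y => (hG y).aestronglyMeasurable)
    ((hG y₀).intervalIntegrable _ _) ?_ ?_ intervalIntegrable_const ?_).2
  · exact (hGy.comp (by fun_prop : Continuous fun x : ℝ => (x, y₀))).aestronglyMeasurable
  · exact Filter.Eventually.of_forall fun x hx y hy => hC (x, y) ⟨Set.uIoc_subset_uIcc hx, hy⟩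
  · exact Filter.Eventually.of_forall fun x _ y _ => hd x y

/-- Let `I G k y` be the `k`-th Fourier integral of the slice at height `y`. It vanishes at `y = h`,
so `|k| |I G k 0|²` is the integral of `-|k| ∂_y |I G k y|² ≤ 2 |k| |I G k y| |I Gy k y|`.
Integration by parts in `x`, without boundary terms, gives `I Gx k = 2πik · I G k`, so the integrand
is at most `|I Gx k|² + |I Gy k|²`. Summing over `k` uses Bessel on each slice. -/
theorem sum_abs_mul_sq_norm_trace_le {G Gx Gy : ℝ → ℝ → ℝ} {h : ℝ} (hh : 0 ≤ h)
    (hGc : Continuous (Function.uncurry G)) (hGxc : Continuous (Function.uncurry Gx))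
    (hGyc : Continuous (Function.uncurry Gy))
    (hx : ∀ x y, HasDerivAt (fun x => G x y) (Gx x y) x)
    (hy : ∀ x y, HasDerivAt (fun y => G x y) (Gy x y) y)
    (h0 : ∀ y, G 0 y = 0) (h2 : ∀ y, G 2 y = 0) (htop : ∀ x, G x h = 0) (S : Finset ℤ) :
    ∑ k ∈ S, |(k : ℝ)| * ‖∫ x in (0 : ℝ)..2, fourier (-k) (x : UnitAddCircle) * (G x 0 : ℂ)‖ ^ 2 ≤
      2 * ∫ y in (0 : ℝ)..h, ∫ x in (0 : ℝ)..2, (Gx x y ^ 2 + Gy x y ^ 2) := by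
  set I : (ℝ → ℝ → ℝ) → ℤ → ℝ → ℂ := fun F k y =>
    ∫ x in (0 : ℝ)..2, fourier (-k) (x : UnitAddCircle) * (F x y : ℂ) with hI
  have hfc := fun k => fourier_coe_unitAddCircle_continuous k
  have hslice : ∀ {F : ℝ → ℝ → ℝ}, Continuous (Function.uncurry F) → ∀ y,
      Continuous fun x => F x y := fun hF y => hF.comp (by fun_prop : Continuous fun x => (x, y))
  have hIcont : ∀ {F : ℝ → ℝ → ℝ}, Continuous (Function.uncurry F) → ∀ k, Continuous (I F k) := by
    intro F hF k
    refine intervalIntegral.continuous_parametric_intervalIntegral_of_continuous' ?_ 0 2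
    refine ((hfc (-k)).comp continuous_snd).mul (Complex.continuous_ofReal.comp ?_)
    exact hF.comp continuous_swap
  have hIderiv : ∀ k y, HasDerivAt (I G k) (I Gy k y) y := by
    intro k y
    refine hasDerivAt_intervalIntegral_of_continuous
      (G := fun x y => fourier (-k) (x : UnitAddCircle) * (G x y : ℂ))
      (Gy := fun x y => fourier (-k) (x : UnitAddCircle) * (Gy x y : ℂ)) 0 2 (fun y => ?_) ?_
      (fun x y => ?_) y
    · exact (hfc (-k)).mul (Complex.continuous_ofReal.comp (hslice hGc y))
    · exact ((hfc (-k)).comp continuous_fst).mul (Complex.continuous_ofReal.comp hGyc)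
    · exact (hy x y).ofReal_comp.const_mul _
  have hIparts : ∀ k y, I Gx k y = 2 * Real.pi * Complex.I * k * I G k y := by
    intro k y
    have h := intervalIntegral.integral_mul_deriv_eq_deriv_mul (a := 0) (b := 2)
      (u := fun x : ℝ => (fourier (-k) (x : UnitAddCircle) : ℂ)) (v := fun x => (G x y : ℂ))
      (fun x _ => hasDerivAt_fourier_neg 1 k x) (fun x _ => (hx x y).ofReal_comp)
      ((continuous_const.mul (hfc (-k))).intervalIntegrable _ _)
      ((Complex.continuous_ofReal.comp (hslice hGxc y)).intervalIntegrable _ _)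
    rw [h0, h2] at h
    simp only [hI]
    rw [h, ← intervalIntegral.integral_const_mul]
    simp only [Complex.ofReal_zero, mul_zero, sub_zero, zero_sub]
    rw [← intervalIntegral.integral_neg]
    congr 1; ext x; push_cast; ring
  have hpt : ∀ k : ℤ, |(k : ℝ)| * ‖I G k 0‖ ^ 2 ≤
      ∫ y in (0 : ℝ)..h, (‖I Gx k y‖ ^ 2 + ‖I Gy k y‖ ^ 2) := by
    intro k
    have hd : ∀ y, HasDerivAt (fun y => ‖I G k y‖ ^ 2) (2 * inner ℝ (I G k y) (I Gy k y)) y :=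
      fun y => (hIderiv k y).norm_sq
    have hc : Continuous fun y => 2 * inner ℝ (I G k y) (I Gy k y) :=
      continuous_const.mul ((hIcont hGc k).inner (hIcont hGyc k))
    have hftc := intervalIntegral.integral_eq_sub_of_hasDerivAt (a := 0) (b := h)
      (fun y _ => hd y) (hc.intervalIntegrable _ _)
    have hend : I G k h = 0 := by simp [hI, htop]
    simp only [hend, norm_zero] at hftc
    have hval : |(k : ℝ)| * ‖I G k 0‖ ^ 2 =
        ∫ y in (0 : ℝ)..h, -(|(k : ℝ)| * (2 * inner ℝ (I G k y) (I Gy k y))) := by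
      rw [intervalIntegral.integral_neg, intervalIntegral.integral_const_mul, hftc]; ring
    rw [hval]
    refine intervalIntegral.integral_mono_on hh ((continuous_const.mul hc).neg.intervalIntegrable _ _)
      ((((hIcont hGxc k).norm.pow 2).add
        ((hIcont hGyc k).norm.pow 2)).intervalIntegrable _ _) fun y _ => ?_
    have h1 := abs_real_inner_le_norm (I G k y) (I Gy k y)
    have h3 : ‖I Gx k y‖ = 2 * Real.pi * |(k : ℝ)| * ‖I G k y‖ := by
      rw [hIparts]
      simp [abs_of_pos Real.pi_pos]
    have h4 : |(k : ℝ)| * ‖I G k y‖ ≤ ‖I Gx k y‖ := by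
      rw [h3, mul_assoc (2 * Real.pi)]
      have hp : (1 : ℝ) ≤ 2 * Real.pi := by linarith [Real.pi_gt_three]
      exact le_mul_of_one_le_left (by positivity) hp
    have h5 : -(|(k : ℝ)| * (2 * inner ℝ (I G k y) (I Gy k y))) ≤
        2 * (|(k : ℝ)| * ‖I G k y‖) * ‖I Gy k y‖ := by
      have := neg_abs_le (inner ℝ (I G k y) (I Gy k y))
      nlinarith [abs_nonneg (k : ℝ)]
    have h6 : 2 * (|(k : ℝ)| * ‖I G k y‖) * ‖I Gy k y‖ ≤ 2 * ‖I Gx k y‖ * ‖I Gy k y‖ := by gcongr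
    nlinarith [sq_nonneg (‖I Gx k y‖ - ‖I Gy k y‖)]
  have hnn : ∀ {F : ℝ → ℝ → ℝ}, Continuous (Function.uncurry F) → ∀ y,
      ∑ k ∈ S, ‖I F k y‖ ^ 2 ≤ 2 * ∫ x in (0 : ℝ)..2, F x y ^ 2 := by
    intro F hF y
    have := sum_sq_norm_intervalIntegral_fourier_le
      (Complex.continuous_ofReal.comp (hslice hF y)) S
    simp only [Function.comp_apply, Complex.norm_real, Real.norm_eq_abs, sq_abs] at this
    exact this
  have hcont2 : ∀ {F : ℝ → ℝ → ℝ}, Continuous (Function.uncurry F) →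
      Continuous fun y => ∫ x in (0 : ℝ)..2, F x y ^ 2 := fun hF =>
    intervalIntegral.continuous_parametric_intervalIntegral_of_continuous'
      ((hF.comp continuous_swap).pow 2) 0 2
  have hadd : ∀ y, ∫ x in (0 : ℝ)..2, (Gx x y ^ 2 + Gy x y ^ 2) =
      (∫ x in (0 : ℝ)..2, Gx x y ^ 2) + ∫ x in (0 : ℝ)..2, Gy x y ^ 2 := fun y =>
    intervalIntegral.integral_add (((hslice hGxc y).pow 2).intervalIntegrable _ _)
      (((hslice hGyc y).pow 2).intervalIntegrable _ _)
  have hIint : ∀ k : ℤ, Continuous fun y => ‖I Gx k y‖ ^ 2 + ‖I Gy k y‖ ^ 2 := fun k =>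
    ((hIcont hGxc k).norm.pow 2).add ((hIcont hGyc k).norm.pow 2)
  calc _ ≤ ∑ k ∈ S, ∫ y in (0 : ℝ)..h, (‖I Gx k y‖ ^ 2 + ‖I Gy k y‖ ^ 2) :=
        Finset.sum_le_sum fun k _ => hpt k
    _ = ∫ y in (0 : ℝ)..h, ∑ k ∈ S, (‖I Gx k y‖ ^ 2 + ‖I Gy k y‖ ^ 2) :=
        (intervalIntegral.integral_finsetSum fun k _ => (hIint k).intervalIntegrable _ _).symm
    _ ≤ ∫ y in (0 : ℝ)..h, 2 * ∫ x in (0 : ℝ)..2, (Gx x y ^ 2 + Gy x y ^ 2) := by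
        refine intervalIntegral.integral_mono_on hh
          ((continuous_finsetSum S fun k _ => hIint k).intervalIntegrable _ _) ?_ fun y _ => ?_
        · simp only [hadd]
          exact (continuous_const.mul ((hcont2 hGxc).add (hcont2 hGyc))).intervalIntegrable _ _
        · rw [hadd, Finset.sum_add_distrib]
          linarith [hnn hGxc y, hnn hGyc y]
    _ = _ := intervalIntegral.integral_const_mul _ _

/-! ### A Caccioppoli inequality from the sub-mean-value property -/

/-- The quadratic function that is positive on an ellipse centred at `1`. -/
noncomputable def ellipseGauge (z : ℂ) : ℝ := 1 - ((z.re - 1) / 2) ^ 2 - (2 * z.im) ^ 2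

/-- A `C¹` cutoff function supported in an ellipse centred at `1`. -/
noncomputable def ellipseCutoff (z : ℂ) : ℝ := max 0 (ellipseGauge z) ^ 2

/-- Minus the derivative of `ellipseGauge` at `z` in the direction `ζ`. -/
noncomputable def ellipseForm (z ζ : ℂ) : ℝ := (z.re - 1) / 2 * ζ.re + 8 * z.im * ζ.im

theorem continuous_ellipseGauge : Continuous ellipseGauge := by
  unfold ellipseGauge; fun_prop

theorem continuous_ellipseCutoff : Continuous ellipseCutoff :=
  (continuous_const.max continuous_ellipseGauge).pow 2

theorem ellipseCutoff_nonneg (z : ℂ) : 0 ≤ ellipseCutoff z := sq_nonneg _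

theorem ellipseGauge_le_one (z : ℂ) : ellipseGauge z ≤ 1 := by
  unfold ellipseGauge; nlinarith [sq_nonneg ((z.re - 1) / 2), sq_nonneg (2 * z.im)]

theorem ellipseCutoff_le_one (z : ℂ) : ellipseCutoff z ≤ 1 :=
  pow_le_one₀ (le_max_left _ _) (max_le zero_le_one (ellipseGauge_le_one z))

theorem ellipseGauge_nonpos {z : ℂ} (hz : 2 ≤ ‖z - 1‖) : ellipseGauge z ≤ 0 := by
  have h : ‖z - 1‖ ^ 2 = (z.re - 1) ^ 2 + z.im ^ 2 := by
    rw [Complex.sq_norm, Complex.normSq_apply]; simp; ring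
  unfold ellipseGauge
  nlinarith [sq_nonneg z.im]

theorem ellipseCutoff_eq_zero {z : ℂ} (hz : 2 ≤ ‖z - 1‖) : ellipseCutoff z = 0 := by
  rw [ellipseCutoff, max_eq_left (ellipseGauge_nonpos hz)]; norm_num

theorem ellipseCutoff_eq_zero_of_notMem {z : ℂ} (hz : z ∉ Metric.closedBall (1 : ℂ) 3) :
    ellipseCutoff z = 0 := by
  rw [Metric.mem_closedBall, dist_eq_norm, not_le] at hz
  exact ellipseCutoff_eq_zero (by linarith)

theorem ellipseCutoff_eq_zero_of_im {z : ℂ} (hz : 1 / 2 ≤ |z.im|) : ellipseCutoff z = 0 := by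
  have h : ellipseGauge z ≤ 0 := by
    unfold ellipseGauge
    have : (1 / 2) ^ 2 ≤ |z.im| ^ 2 := by gcongr
    rw [sq_abs] at this
    nlinarith [sq_nonneg ((z.re - 1) / 2)]
  rw [ellipseCutoff, max_eq_left h]; norm_num

theorem max_zero_add_sq_le (s d : ℝ) :
    max 0 (s + d) ^ 2 ≤ max 0 s ^ 2 + 2 * max 0 s * d + d ^ 2 := by
  rcases le_total 0 s with hs | hs <;> rcases le_total 0 (s + d) with h | h <;>
    simp only [max_eq_left, max_eq_right, hs, h] <;> nlinarith [sq_nonneg (s + d)]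

/-- A second-order Taylor bound, needed only from above since it will be multiplied by a nonnegative
function. The linear term will cancel over a circle of `ζ`. On the ball the increment of the gauge
is at most `26‖ζ‖ + 4‖ζ‖`, whence `900 = 30²`; outside it all the cutoff terms vanish. -/
theorem ellipseCutoff_sub_le {z ζ : ℂ} (hζ : ‖ζ‖ ≤ 1) :
    ellipseCutoff (z - ζ) ≤ ellipseCutoff z + 2 * max 0 (ellipseGauge z) * ellipseForm z ζ +
      (Metric.closedBall (1 : ℂ) 3).indicator (fun _ => 900 * ‖ζ‖ ^ 2) z := by
  by_cases hz : z ∈ Metric.closedBall (1 : ℂ) 3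
  · rw [Set.indicator_of_mem hz]
    rw [Metric.mem_closedBall, dist_eq_norm] at hz
    have h1 : |z.re - 1| ≤ 3 := by
      have := Complex.abs_re_le_norm (z - 1); simp at this; linarith
    have h2 : |z.im| ≤ 3 := by
      have := Complex.abs_im_le_norm (z - 1); simp at this; linarith
    have h3 := Complex.abs_re_le_norm ζ
    have h4 := Complex.abs_im_le_norm ζ
    have hq : ‖ζ‖ ^ 2 = ζ.re ^ 2 + ζ.im ^ 2 := by
      rw [Complex.sq_norm, Complex.normSq_apply]; ring
    set Q : ℝ := ζ.re ^ 2 / 4 + 4 * ζ.im ^ 2 with hQ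
    have hQ0 : 0 ≤ Q := by positivity
    have hQ1 : Q ≤ 4 * ‖ζ‖ := by nlinarith [norm_nonneg ζ, sq_nonneg ζ.re]
    have hexp : ellipseGauge (z - ζ) = ellipseGauge z + (ellipseForm z ζ - Q) := by
      simp only [ellipseGauge, ellipseForm, hQ, Complex.sub_re, Complex.sub_im]; ring
    have hform : |ellipseForm z ζ| ≤ 26 * ‖ζ‖ := by
      unfold ellipseForm
      refine (abs_add_le _ _).trans ?_
      rw [abs_mul, abs_mul, abs_div, abs_mul, abs_two, abs_of_pos (by norm_num : (0 : ℝ) < 8)]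
      have e1 : |z.re - 1| / 2 * |ζ.re| ≤ 3 / 2 * ‖ζ‖ := by gcongr
      have e2 : 8 * |z.im| * |ζ.im| ≤ 8 * 3 * ‖ζ‖ := by gcongr
      linarith [norm_nonneg ζ]
    have hd : (ellipseForm z ζ - Q) ^ 2 ≤ 900 * ‖ζ‖ ^ 2 := by
      have e : |ellipseForm z ζ - Q| ≤ 30 * ‖ζ‖ := by
        refine (abs_sub _ _).trans ?_
        rw [abs_of_nonneg hQ0]; linarith
      calc _ = |ellipseForm z ζ - Q| ^ 2 := (sq_abs _).symm
        _ ≤ (30 * ‖ζ‖) ^ 2 := by gcongr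
        _ = _ := by ring
    have hmain := max_zero_add_sq_le (ellipseGauge z) (ellipseForm z ζ - Q)
    rw [← hexp] at hmain
    have hp : 0 ≤ max 0 (ellipseGauge z) * Q := mul_nonneg (le_max_left _ _) hQ0
    unfold ellipseCutoff
    nlinarith
  · rw [Set.indicator_of_notMem hz]
    rw [Metric.mem_closedBall, dist_eq_norm, not_le] at hz
    have h1 : 2 ≤ ‖z - ζ - 1‖ := by
      have := norm_sub_norm_le (z - 1) ζ
      rw [show z - ζ - 1 = z - 1 - ζ by ring]; linarith
    rw [ellipseCutoff_eq_zero h1, ellipseCutoff_eq_zero (by linarith),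
      max_eq_left (ellipseGauge_nonpos (by linarith))]
    simp

theorem circleMap_eq_add_circleMap_zero (z : ℂ) (r θ : ℝ) :
    circleMap z r θ = z + circleMap 0 r θ := by
  simp [circleMap]

/-- A discrete form of `2|∇W|² ≤ Δ(W + B)²`, followed by moving the Laplacian to the cutoff. With `f
= (W + B)²` one has `(W(w) - W(z))² = f(w) - f(z) - 2(W(z) + B)(W(w) - W(z))`, and over a circle the
last product has nonnegative mean, because `W + B ≥ 0` and `W` has the sub-mean-value property.
Translating the variable puts the difference on the cutoff, where only the second-order term `900
r²` survives. -/
theorem integral_cutoff_mul_sq_sub_le {W : ℂ → ℝ} (hW : Continuous W) {B : ℝ}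
    (hB : ∀ z, |W z| ≤ B) {r : ℝ} (hr0 : 0 ≤ r) (hr1 : r ≤ 1)
    (hsub : ∀ z ∈ Metric.closedBall (1 : ℂ) 3, |z.im| ≤ 1 / 2 → W z ≤ Real.circleAverage W z r) :
    ∫ z in Metric.closedBall (1 : ℂ) 3, ellipseCutoff z *
        ∫ θ in (0 : ℝ)..2 * Real.pi, (W (circleMap z r θ) - W z) ^ 2 ≤
      7200 * volume.real (Metric.closedBall (1 : ℂ) 3) * Real.pi * B ^ 2 * r ^ 2 := by
  set D := Metric.closedBall (1 : ℂ) 3 with hD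
  have hpi : 0 ≤ 2 * Real.pi := by positivity
  have hB0 : 0 ≤ B := (abs_nonneg _).trans (hB 0)
  have : IsFiniteMeasure (volume.restrict D : Measure ℂ) :=
    ⟨by rw [Measure.restrict_apply_univ]; exact measure_closedBall_lt_top⟩
  have hcirc : Continuous fun p : ℂ × ℝ => circleMap p.1 r p.2 := by
    unfold circleMap; fun_prop
  have hcirc0 : Continuous fun θ : ℝ => circleMap 0 r θ := by
    unfold circleMap; fun_prop
  set f : ℂ → ℝ := fun z => (W z + B) ^ 2 with hf
  have hfc : Continuous f := (hW.add continuous_const).pow 2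
  have hf0 : ∀ z, 0 ≤ f z := fun z => sq_nonneg _
  have hf1 : ∀ z, f z ≤ 4 * B ^ 2 := fun z => by
    have := abs_le.1 (hB z)
    simp only [hf]; nlinarith
  have hcmp : ∀ z : ℂ, ellipseCutoff z *
      ∫ θ in (0 : ℝ)..2 * Real.pi, (W (circleMap z r θ) - W z) ^ 2 ≤
        ellipseCutoff z * ∫ θ in (0 : ℝ)..2 * Real.pi, (f (circleMap z r θ) - f z) := by
    intro z
    by_cases hzD : z ∈ D
    swap
    · rw [ellipseCutoff_eq_zero_of_notMem hzD]; simp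
    by_cases hz : |z.im| ≤ 1 / 2
    · refine mul_le_mul_of_nonneg_left ?_ (ellipseCutoff_nonneg z)
      have hcz : Continuous fun θ : ℝ => circleMap z r θ := hcirc.comp (by fun_prop : Continuous
        fun θ : ℝ => (z, θ))
      have hWz : Continuous fun θ : ℝ => W (circleMap z r θ) := hW.comp hcz
      have hWd : Continuous fun θ : ℝ => W (circleMap z r θ) - W z := hWz.sub continuous_const
      have hWd2 : Continuous fun θ : ℝ => (W (circleMap z r θ) - W z) ^ 2 := hWd.pow 2
      have hWd3 : Continuous fun θ : ℝ => 2 * (W z + B) * (W (circleMap z r θ) - W z) :=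
        continuous_const.mul hWd
      have h1 : (fun θ => f (circleMap z r θ) - f z) = fun θ => (W (circleMap z r θ) - W z) ^ 2 +
          2 * (W z + B) * (W (circleMap z r θ) - W z) := by
        ext θ; simp only [hf]; ring
      rw [h1, intervalIntegral.integral_add (hWd2.intervalIntegrable _ _)
        (hWd3.intervalIntegrable _ _),
        intervalIntegral.integral_const_mul]
      have h2 := hsub z hzD hz
      rw [Real.circleAverage_def, smul_eq_mul, inv_mul_eq_div, le_div_iff₀ (by positivity)] at h2
      have h3 : 0 ≤ ∫ θ in (0 : ℝ)..2 * Real.pi, (W (circleMap z r θ) - W z) := by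
        rw [intervalIntegral.integral_sub (hWz.intervalIntegrable _ _)
          (continuous_const.intervalIntegrable _ _), intervalIntegral.integral_const]
        simp only [sub_zero, smul_eq_mul]
        linarith
      have h4 : 0 ≤ 2 * (W z + B) := by linarith [(abs_le.1 (hB z)).1]
      have := mul_nonneg h4 h3
      linarith
    · rw [ellipseCutoff_eq_zero_of_im (not_le.1 hz).le]; simp
  have hparam : ∀ {g : ℂ → ℝ → ℝ}, Continuous (Function.uncurry g) →
      Continuous fun z => ellipseCutoff z * ∫ θ in (0 : ℝ)..2 * Real.pi, g z θ := fun hg =>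
    continuous_ellipseCutoff.mul
      (intervalIntegral.continuous_parametric_intervalIntegral_of_continuous' hg _ _)
  have hDi : ∀ {g : ℂ → ℝ}, Continuous g → IntegrableOn g D volume := fun hg =>
    hg.continuousOn.integrableOn_compact (isCompact_closedBall _ _)
  have hWW : Continuous (Function.uncurry fun (z : ℂ) (θ : ℝ) => (W (circleMap z r θ) - W z) ^ 2) :=
    ((hW.comp hcirc).sub (hW.comp continuous_fst)).pow 2
  have hff : Continuous (Function.uncurry fun (z : ℂ) (θ : ℝ) => (f (circleMap z r θ) - f z)) :=
    (hfc.comp hcirc).sub (hfc.comp continuous_fst)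
  have hswap : ∫ z in D, ellipseCutoff z *
      (∫ θ in (0 : ℝ)..2 * Real.pi, (f (circleMap z r θ) - f z)) =
      ∫ θ in (0 : ℝ)..2 * Real.pi, ∫ z in D,
        ellipseCutoff z * (f (circleMap z r θ) - f z) := by
    simp only [intervalIntegral.integral_of_le hpi, ← integral_const_mul]
    refine integral_integral_swap ?_
    refine integrable_of_measurable_bounded (C := 4 * B ^ 2) ?_ fun p => ?_
    · exact ((continuous_ellipseCutoff.comp continuous_fst).mul hff).measurable
    · simp only [Function.uncurry, norm_mul]
      rw [Real.norm_eq_abs, Real.norm_eq_abs, abs_of_nonneg (ellipseCutoff_nonneg _),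
        ← one_mul (4 * B ^ 2)]
      refine mul_le_mul (ellipseCutoff_le_one _) ?_ (abs_nonneg _) zero_le_one
      rw [abs_le]
      constructor <;> linarith [hf0 p.1, hf1 p.1, hf0 (circleMap p.1 r p.2),
        hf1 (circleMap p.1 r p.2)]
  have hshift : ∀ ζ : ℂ, ‖ζ‖ ≤ 1 → ∫ z in D, ellipseCutoff z * (f (z + ζ) - f z) =
      ∫ z in D, f z * (ellipseCutoff (z - ζ) - ellipseCutoff z) := by
    intro ζ hζ
    have hc1 : Continuous fun z => ellipseCutoff z * f (z + ζ) :=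
      continuous_ellipseCutoff.mul (hfc.comp (continuous_add_const ζ))
    have hc2 : Continuous fun z => ellipseCutoff (z - ζ) * f z :=
      (continuous_ellipseCutoff.comp (continuous_sub_right ζ)).mul hfc
    have h1 : ∫ z in D, ellipseCutoff z * f (z + ζ) = ∫ z in D, ellipseCutoff (z - ζ) * f z := by
      rw [setIntegral_eq_integral_of_forall_compl_eq_zero fun z hz => by
          rw [ellipseCutoff_eq_zero_of_notMem hz, zero_mul],
        setIntegral_eq_integral_of_forall_compl_eq_zero fun z hz => ?_,
        ← integral_add_right_eq_self (fun z => ellipseCutoff (z - ζ) * f z) ζ]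
      · simp
      · rw [hD, Metric.mem_closedBall, dist_eq_norm, not_le] at hz
        have : 2 ≤ ‖z - ζ - 1‖ := by
          have := norm_sub_norm_le (z - 1) ζ
          rw [show z - ζ - 1 = z - 1 - ζ by ring]; linarith
        rw [ellipseCutoff_eq_zero this, zero_mul]
    have hc3 : Continuous fun z => ellipseCutoff z * f z := continuous_ellipseCutoff.mul hfc
    have h2 : ∫ z in D, ellipseCutoff z * (f (z + ζ) - f z) =
        (∫ z in D, ellipseCutoff z * f (z + ζ)) - ∫ z in D, ellipseCutoff z * f z := by
      rw [← integral_sub (hDi hc1) (hDi hc3)]; simp only [mul_sub]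
    have h3 : ∫ z in D, f z * (ellipseCutoff (z - ζ) - ellipseCutoff z) =
        (∫ z in D, ellipseCutoff (z - ζ) * f z) - ∫ z in D, ellipseCutoff z * f z := by
      rw [← integral_sub (hDi hc2) (hDi hc3)]; congr 1; ext z; ring
    rw [h2, h3, h1]
  -- `c₁` and `c₂` are the coefficients of the part linear in `ζ`; they are never estimated, since
  -- `cos` and `sin` integrate to zero over the circle.
  set p : ℂ → ℝ := fun z => f z * (2 * max 0 (ellipseGauge z)) with hp
  have hpc : Continuous p :=
    hfc.mul (continuous_const.mul (continuous_const.max continuous_ellipseGauge))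
  set c₁ : ℝ := ∫ z in D, p z * ((z.re - 1) / 2) with hc₁
  set c₂ : ℝ := ∫ z in D, p z * (8 * z.im) with hc₂
  have hbound : ∀ ζ : ℂ, ‖ζ‖ = r → ∫ z in D, f z * (ellipseCutoff (z - ζ) - ellipseCutoff z) ≤
      (c₁ * ζ.re + c₂ * ζ.im) + 4 * B ^ 2 * (900 * r ^ 2) * volume.real D := by
    intro ζ hζ
    have hi1 : IntegrableOn (fun z : ℂ => p z * ((z.re - 1) / 2)) D volume :=
      hDi (hpc.mul (by fun_prop))
    have hi2 : IntegrableOn (fun z : ℂ => p z * (8 * z.im)) D volume :=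
      hDi (hpc.mul (by fun_prop))
    calc _ ≤ ∫ z in D, ((p z * ((z.re - 1) / 2) * ζ.re + p z * (8 * z.im) * ζ.im) +
          4 * B ^ 2 * (900 * r ^ 2)) := by
          refine setIntegral_mono_on (hDi (hfc.mul ((continuous_ellipseCutoff.comp
            (continuous_sub_right ζ)).sub continuous_ellipseCutoff)))
            (((hi1.mul_const _).add (hi2.mul_const _)).add (integrable_const _))
            Metric.isClosed_closedBall.measurableSet fun z hz => ?_
          have h1 := ellipseCutoff_sub_le (z := z) (hζ.le.trans hr1)
          rw [← hD, Set.indicator_of_mem hz, hζ] at h1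
          have h2 : f z * (ellipseCutoff (z - ζ) - ellipseCutoff z) ≤
              f z * (2 * max 0 (ellipseGauge z) * ellipseForm z ζ + 900 * r ^ 2) :=
            mul_le_mul_of_nonneg_left (by linarith) (hf0 z)
          have h3 : f z * (900 * r ^ 2) ≤ 4 * B ^ 2 * (900 * r ^ 2) :=
            mul_le_mul_of_nonneg_right (hf1 z) (by positivity)
          have h4 : p z * ((z.re - 1) / 2) * ζ.re + p z * (8 * z.im) * ζ.im =
              f z * (2 * max 0 (ellipseGauge z) * ellipseForm z ζ) := by
            simp only [hp, ellipseForm]; ring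
          rw [h4]
          linarith
      _ = _ := by
          have hi12 : IntegrableOn (fun z : ℂ => p z * ((z.re - 1) / 2) * ζ.re +
            p z * (8 * z.im) * ζ.im) D volume := (hi1.mul_const _).add (hi2.mul_const _)
          rw [integral_add hi12 (integrable_const _), integral_add (hi1.mul_const _) (hi2.mul_const _), integral_mul_const,
            integral_mul_const, integral_const, smul_eq_mul, measureReal_restrict_apply_univ]
          ring
  have hre : ∀ θ : ℝ, (circleMap 0 r θ).re = r * Real.cos θ := fun θ => by
    simp [circleMap, Complex.exp_ofReal_mul_I_re]
  have him : ∀ θ : ℝ, (circleMap 0 r θ).im = r * Real.sin θ := fun θ => by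
    simp [circleMap, Complex.exp_ofReal_mul_I_im]
  have hnorm : ∀ θ : ℝ, ‖circleMap 0 r θ‖ = r := fun θ => by
    rw [norm_circleMap_zero, abs_of_nonneg hr0]
  calc _ ≤ ∫ z in D, ellipseCutoff z *
        ∫ θ in (0 : ℝ)..2 * Real.pi, (f (circleMap z r θ) - f z) :=
        setIntegral_mono (hDi (hparam hWW)) (hDi (hparam hff)) hcmp
    _ = ∫ θ in (0 : ℝ)..2 * Real.pi, ∫ z in D,
        f z * (ellipseCutoff (z - circleMap 0 r θ) - ellipseCutoff z) := by
        rw [hswap]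
        congr 1; ext θ
        rw [← hshift _ ((hnorm θ).le.trans hr1)]
        congr 1; ext z
        rw [circleMap_eq_add_circleMap_zero z r θ]
    _ ≤ ∫ θ in (0 : ℝ)..2 * Real.pi, ((c₁ * (r * Real.cos θ) + c₂ * (r * Real.sin θ)) +
        4 * B ^ 2 * (900 * r ^ 2) * volume.real D) := by
        refine intervalIntegral.integral_mono_on hpi ?_ ?_ fun θ _ => ?_
        · refine Continuous.intervalIntegrable ?_ _ _
          refine continuous_parametric_integral_of_continuous ?_ (isCompact_closedBall _ _)
          exact (hfc.comp continuous_snd).mul ((continuous_ellipseCutoff.comp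
            (continuous_snd.sub (hcirc0.comp continuous_fst))).sub
              (continuous_ellipseCutoff.comp continuous_snd))
        · exact Continuous.intervalIntegrable (by fun_prop) _ _
        · have := hbound _ (hnorm θ)
          rwa [hre, him] at this
    _ = _ := by
        rw [intervalIntegral.integral_add
          (Continuous.intervalIntegrable (by fun_prop) _ _) intervalIntegrable_const,
          intervalIntegral.integral_add
          (Continuous.intervalIntegrable (by fun_prop) _ _)
          (Continuous.intervalIntegrable (by fun_prop) _ _)]
        simp only [intervalIntegral.integral_const_mul, integral_cos, integral_sin,
          intervalIntegral.integral_const, Real.sin_two_pi, Real.cos_two_pi, Real.sin_zero,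
          Real.cos_zero, smul_eq_mul]
        ring

theorem integral_sq_cos_add_sin (a b : ℝ) :
    ∫ θ in (0 : ℝ)..2 * Real.pi, (a * Real.cos θ + b * Real.sin θ) ^ 2 =
      Real.pi * (a ^ 2 + b ^ 2) := by
  have h : ∀ θ : ℝ, (a * Real.cos θ + b * Real.sin θ) ^ 2 =
      a ^ 2 * Real.cos θ ^ 2 + 2 * a * b * (Real.sin θ * Real.cos θ) + b ^ 2 * Real.sin θ ^ 2 :=
    fun θ => by ring
  simp only [h]
  rw [intervalIntegral.integral_add (Continuous.intervalIntegrable (by fun_prop) _ _)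
      (Continuous.intervalIntegrable (by fun_prop) _ _),
    intervalIntegral.integral_add (Continuous.intervalIntegrable (by fun_prop) _ _)
      (Continuous.intervalIntegrable (by fun_prop) _ _),
    intervalIntegral.integral_const_mul, intervalIntegral.integral_const_mul,
    intervalIntegral.integral_const_mul, integral_cos_sq, integral_sin_sq, integral_sin_mul_cos₁]
  simp only [Real.sin_two_pi, Real.cos_two_pi, Real.sin_zero, Real.cos_zero]
  ring

theorem intervalIntegral_const_add_const_mul {f : ℝ → ℝ} (hf : Continuous f) (a b c d : ℝ) :
    ∫ x in a..b, (c + d * f x) = (b - a) * c + d * ∫ x in a..b, f x := by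
  have h : Continuous fun x => d * f x := continuous_const.mul hf
  rw [intervalIntegral.integral_add intervalIntegrable_const (h.intervalIntegrable _ _),
    intervalIntegral.integral_const, intervalIntegral.integral_const_mul, smul_eq_mul]

/-- Divide the preceding estimate by `r²` and let `r → 0`. The difference quotients are dominated by
the Lipschitz constant, which does not enter the result, and the mean over directions turns their
limit into `π|∇W|²`. -/
theorem integral_cutoff_mul_fderiv_sq_le {W : ℂ → ℝ} (hW : ContDiff ℝ 1 W) {L : NNReal}
    (hL : LipschitzWith L W) {B : ℝ} (hB : ∀ z, |W z| ≤ B) {ρ : ℝ} (hρ : 0 < ρ)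
    (hsub : ∀ z ∈ Metric.closedBall (1 : ℂ) 3, |z.im| ≤ 1 / 2 → ∀ r, 0 < r → r < ρ →
      W z ≤ Real.circleAverage W z r) :
    ∫ z in Metric.closedBall (1 : ℂ) 3, ellipseCutoff z *
        ((fderiv ℝ W z 1) ^ 2 + (fderiv ℝ W z Complex.I) ^ 2) ≤
      7200 * volume.real (Metric.closedBall (1 : ℂ) 3) * B ^ 2 := by
  set D := Metric.closedBall (1 : ℂ) 3 with hD
  have hWc : Continuous W := hW.continuous
  have hpi : 0 ≤ 2 * Real.pi := by positivity
  have : IsFiniteMeasure (volume.restrict D : Measure ℂ) :=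
    ⟨by rw [Measure.restrict_apply_univ]; exact measure_closedBall_lt_top⟩
  set q : ℝ → ℂ → ℝ → ℝ := fun r z θ => (r⁻¹ * (W (circleMap z r θ) - W z)) ^ 2 with hq
  have hqb : ∀ r, 0 < r → ∀ z θ, |q r z θ| ≤ (L : ℝ) ^ 2 := by
    intro r hr z θ
    have h1 := hL.dist_le_mul (circleMap z r θ) z
    rw [Real.dist_eq, dist_eq_norm, circleMap_sub_center, norm_circleMap_zero, abs_of_pos hr] at h1
    simp only [hq]
    rw [abs_pow, abs_mul, abs_inv, abs_of_pos hr]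
    gcongr
    rw [inv_mul_le_iff₀ hr]
    linarith
  have hqc : ∀ r, Continuous (Function.uncurry (q r)) := fun r => by
    have hcirc : Continuous fun p : ℂ × ℝ => circleMap p.1 r p.2 := by unfold circleMap; fun_prop
    exact (continuous_const.mul ((hWc.comp hcirc).sub (hWc.comp continuous_fst))).pow 2
  have hlim : ∀ z θ, Filter.Tendsto (fun r => q r z θ) (nhdsWithin 0 (Set.Ioi 0))
      (nhds ((fderiv ℝ W z 1 * Real.cos θ + fderiv ℝ W z Complex.I * Real.sin θ) ^ 2)) := by
    intro z θ
    have hd : HasFDerivAt W (fderiv ℝ W z) z :=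
      (hW.differentiable (by norm_num) z).hasFDerivAt
    have h1 := ((hd.hasLineDerivAt (Complex.exp (θ * Complex.I))).tendsto_slope_zero_right).pow 2
    have h2 : fderiv ℝ W z (Complex.exp (θ * Complex.I)) =
        fderiv ℝ W z 1 * Real.cos θ + fderiv ℝ W z Complex.I * Real.sin θ := by
      have : Complex.exp (θ * Complex.I) =
          Real.cos θ • (1 : ℂ) + Real.sin θ • Complex.I := by
        rw [Complex.exp_mul_I]; simp
      rw [this, map_add, map_smul, map_smul, smul_eq_mul, smul_eq_mul]; ring
    rw [h2] at h1
    refine h1.congr fun r => ?_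
    simp only [hq, smul_eq_mul, circleMap, Complex.real_smul]
  have hinner : ∀ z, Filter.Tendsto (fun r => ∫ θ in (0 : ℝ)..2 * Real.pi, q r z θ)
      (nhdsWithin 0 (Set.Ioi 0))
      (nhds (Real.pi * ((fderiv ℝ W z 1) ^ 2 + (fderiv ℝ W z Complex.I) ^ 2))) := by
    intro z
    rw [← integral_sq_cos_add_sin]
    refine intervalIntegral.tendsto_integral_filter_of_dominated_convergence
      (fun _ => (L : ℝ) ^ 2) ?_ ?_ intervalIntegrable_const ?_
    · exact Filter.Eventually.of_forall fun r =>
        ((hqc r).comp (by fun_prop : Continuous fun θ : ℝ => (z, θ))).aestronglyMeasurable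
    · filter_upwards [self_mem_nhdsWithin] with r hr
      exact Filter.Eventually.of_forall fun θ _ => hqb r hr z θ
    · exact Filter.Eventually.of_forall fun θ _ => hlim z θ
  have houter : Filter.Tendsto
      (fun r => ∫ z in D, ellipseCutoff z * ∫ θ in (0 : ℝ)..2 * Real.pi, q r z θ)
      (nhdsWithin 0 (Set.Ioi 0))
      (nhds (∫ z in D, ellipseCutoff z *
        (Real.pi * ((fderiv ℝ W z 1) ^ 2 + (fderiv ℝ W z Complex.I) ^ 2)))) := by
    refine tendsto_integral_filter_of_dominated_convergence
      (fun _ => (L : ℝ) ^ 2 * (2 * Real.pi)) ?_ ?_ ?_ ?_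
    · exact Filter.Eventually.of_forall fun r => (continuous_ellipseCutoff.mul
        (intervalIntegral.continuous_parametric_intervalIntegral_of_continuous'
          (hqc r) _ _)).aestronglyMeasurable
    · filter_upwards [self_mem_nhdsWithin] with r hr
      refine Filter.Eventually.of_forall fun z => ?_
      rw [norm_mul, Real.norm_eq_abs, abs_of_nonneg (ellipseCutoff_nonneg z),
        ← one_mul ((L : ℝ) ^ 2 * (2 * Real.pi))]
      refine mul_le_mul (ellipseCutoff_le_one z) ?_ (norm_nonneg _) zero_le_one
      have := intervalIntegral.norm_integral_le_of_norm_le_const (a := 0) (b := 2 * Real.pi)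
        (f := q r z) (C := (L : ℝ) ^ 2) fun θ _ => hqb r hr z θ
      rwa [sub_zero, abs_of_nonneg hpi] at this
    · exact integrable_const _
    · exact Filter.Eventually.of_forall fun z => (hinner z).const_mul _
  have hle : ∫ z in D, ellipseCutoff z *
        (Real.pi * ((fderiv ℝ W z 1) ^ 2 + (fderiv ℝ W z Complex.I) ^ 2)) ≤
      7200 * volume.real D * Real.pi * B ^ 2 := by
    refine le_of_tendsto houter ?_
    filter_upwards [Ioo_mem_nhdsGT (lt_min hρ one_pos)] with r hr
    have hr0 : 0 < r := hr.1
    have h1 := integral_cutoff_mul_sq_sub_le hWc hB hr0.le (hr.2.le.trans (min_le_right _ _))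
      fun z hzD hz => hsub z hzD hz r hr0 (hr.2.trans_le (min_le_left _ _))
    have h2 : ∀ z, ellipseCutoff z * ∫ θ in (0 : ℝ)..2 * Real.pi, q r z θ =
        (r ^ 2)⁻¹ * (ellipseCutoff z *
          ∫ θ in (0 : ℝ)..2 * Real.pi, (W (circleMap z r θ) - W z) ^ 2) := by
      intro z
      simp only [hq, mul_pow]
      rw [intervalIntegral.integral_const_mul, inv_pow]; ring
    simp only [h2]
    rw [integral_const_mul, inv_mul_le_iff₀ (by positivity)]
    linarith
  have h3 : ∀ z, ellipseCutoff z *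
      (Real.pi * ((fderiv ℝ W z 1) ^ 2 + (fderiv ℝ W z Complex.I) ^ 2)) =
      Real.pi * (ellipseCutoff z * ((fderiv ℝ W z 1) ^ 2 + (fderiv ℝ W z Complex.I) ^ 2)) :=
    fun z => by ring
  simp only [h3] at hle
  rw [integral_const_mul] at hle
  have h4 : Real.pi * (∫ z in D, ellipseCutoff z *
      ((fderiv ℝ W z 1) ^ 2 + (fderiv ℝ W z Complex.I) ^ 2)) ≤
      Real.pi * (7200 * volume.real D * B ^ 2) := by linarith
  exact le_of_mul_le_mul_left h4 Real.pi_pos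

/-- On the rectangle the gauge is at least `1 - 1/4 - 1/4 = 1/2`, so the cutoff is at least `1/4`.
-/
theorem intervalIntegral_intervalIntegral_le_setIntegral_cutoff {g : ℂ → ℝ} (hg : Continuous g)
    (hg0 : ∀ z, 0 ≤ g z) :
    ∫ y in (0 : ℝ)..1 / 4, ∫ x in (0 : ℝ)..2, g (x + y * Complex.I) ≤
      4 * ∫ z in Metric.closedBall (1 : ℂ) 3, ellipseCutoff z * g z := by
  set D := Metric.closedBall (1 : ℂ) 3 with hD
  set Q : Set (ℝ × ℝ) := Set.Ioc (0 : ℝ) 2 ×ˢ Set.Ioc (0 : ℝ) (1 / 4) with hQ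
  set R : Set ℂ := Complex.measurableEquivRealProd ⁻¹' Q with hR
  have hRm : MeasurableSet R :=
    Complex.measurableEquivRealProd.measurable (measurableSet_Ioc.prod measurableSet_Ioc)
  have hRmem : ∀ z, z ∈ R → (0 < z.re ∧ z.re ≤ 2) ∧ (0 < z.im ∧ z.im ≤ 1 / 4) := fun z hz => hz
  have hRD : R ⊆ D := by
    intro z hz
    obtain ⟨⟨h1, h2⟩, h3, h4⟩ := hRmem z hz
    rw [hD, Metric.mem_closedBall, dist_eq_norm]
    refine (Complex.norm_le_abs_re_add_abs_im _).trans ?_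
    have e1 : |(z - 1).re| ≤ 1 := by rw [abs_le]; simp; constructor <;> linarith
    have e2 : |(z - 1).im| ≤ 1 := by rw [abs_le]; simp; constructor <;> linarith
    linarith
  have hcut : ∀ z ∈ R, 1 / 4 ≤ ellipseCutoff z := by
    intro z hz
    obtain ⟨⟨h1, h2⟩, h3, h4⟩ := hRmem z hz
    have h5 : 1 / 2 ≤ ellipseGauge z := by
      unfold ellipseGauge
      nlinarith
    unfold ellipseCutoff
    rw [max_eq_right (by linarith)]
    nlinarith
  have hG : Continuous fun p : ℝ × ℝ => g (p.1 + p.2 * Complex.I) :=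
    hg.comp (by fun_prop)
  have hGi : IntegrableOn (fun p : ℝ × ℝ => g (p.1 + p.2 * Complex.I)) Q
      ((volume : Measure ℝ).prod volume) :=
    (hG.continuousOn.integrableOn_compact (isCompact_Icc.prod isCompact_Icc)).mono_set
      (Set.prod_mono Set.Ioc_subset_Icc_self Set.Ioc_subset_Icc_self)
  have hfub : ∫ y in (0 : ℝ)..1 / 4, ∫ x in (0 : ℝ)..2, g (x + y * Complex.I) =
      ∫ z in R, g z := by
    have h1 := Complex.volume_preserving_equiv_real_prod.setIntegral_preimage_emb
      Complex.measurableEquivRealProd.measurableEmbedding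
      (fun p : ℝ × ℝ => g (p.1 + p.2 * Complex.I)) Q
    rw [← hR] at h1
    have h2 : ∀ z : ℂ, g (((Complex.measurableEquivRealProd z).1 : ℂ) +
        ((Complex.measurableEquivRealProd z).2 : ℂ) * Complex.I) = g z := fun z => by
      congr 1; exact Complex.re_add_im z
    simp only [h2] at h1
    rw [h1, Measure.volume_eq_prod, setIntegral_prod _ hGi, integral_integral_swap]
    · simp only [intervalIntegral.integral_of_le (by norm_num : (0 : ℝ) ≤ 1 / 4),
        intervalIntegral.integral_of_le (by norm_num : (0 : ℝ) ≤ 2)]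
    · rw [Measure.prod_restrict]; exact hGi
  have hgD : ∀ {k : ℂ → ℝ}, Continuous k → IntegrableOn k D volume := fun hk =>
    hk.continuousOn.integrableOn_compact (isCompact_closedBall _ _)
  have hcg : Continuous fun z => 4 * (ellipseCutoff z * g z) :=
    continuous_const.mul (continuous_ellipseCutoff.mul hg)
  rw [hfub, ← integral_const_mul]
  calc ∫ z in R, g z ≤ ∫ z in R, 4 * (ellipseCutoff z * g z) :=
        setIntegral_mono_on ((hgD hg).mono_set hRD) ((hgD hcg).mono_set hRD) hRm fun z hz => by
          nlinarith [hcut z hz, hg0 z]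
    _ ≤ _ := setIntegral_mono_set (hgD hcg)
        (Filter.Eventually.of_forall fun z =>
          mul_nonneg (by norm_num) (mul_nonneg (ellipseCutoff_nonneg z) (hg0 z)))
        (Filter.Eventually.of_forall hRD)

/-- The trace inequality is applied to `κ(x)(1 - 4y) W(x + iy)` with `κ(x) = sin²(πx/2)`: it
vanishes at `x = 0`, `x = 2` and `y = 1/4`, as required, and equals `κ W` on the real axis. -/
theorem sum_abs_mul_sq_norm_fourier_cutoff_le {W : ℂ → ℝ} (hW : ContDiff ℝ 1 W) {L : NNReal}
    (hL : LipschitzWith L W) {B : ℝ} (hB : ∀ z, |W z| ≤ B) {ρ : ℝ} (hρ : 0 < ρ)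
    (hsub : ∀ z ∈ Metric.closedBall (1 : ℂ) 3, |z.im| ≤ 1 / 2 → ∀ r, 0 < r → r < ρ →
      W z ≤ Real.circleAverage W z r)
    (S : Finset ℤ) :
    ∑ k ∈ S, |(k : ℝ)| * ‖∫ x in (0 : ℝ)..2, fourier (-k) (x : UnitAddCircle) *
        ((Real.sin (Real.pi / 2 * x) ^ 2 * W x : ℝ) : ℂ)‖ ^ 2 ≤
      (115200 * volume.real (Metric.closedBall (1 : ℂ) 3) + 100) * B ^ 2 := by
  set κ : ℝ → ℝ := fun x => Real.sin (Real.pi / 2 * x) ^ 2 with hκ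
  set κ' : ℝ → ℝ := fun x => Real.pi * (Real.sin (Real.pi / 2 * x) * Real.cos (Real.pi / 2 * x))
    with hκ'
  have hκd : ∀ x, HasDerivAt κ (κ' x) x := by
    intro x
    have h1 : HasDerivAt (fun x : ℝ => Real.pi / 2 * x) (Real.pi / 2) x := by
      simpa using (hasDerivAt_id x).const_mul (Real.pi / 2)
    exact ((h1.sin).pow 2).congr_deriv (by simp only [hκ']; push_cast; ring)
  have hκ1 : ∀ x, |κ x| ≤ 1 := fun x => by
    simp only [hκ]; rw [abs_pow]; exact pow_le_one₀ (abs_nonneg _) (Real.abs_sin_le_one _)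
  have hκ'1 : ∀ x, |κ' x| ≤ 4 := fun x => by
    simp only [hκ']
    rw [abs_mul, abs_mul, abs_of_pos Real.pi_pos]
    have h1 : |Real.sin (Real.pi / 2 * x)| * |Real.cos (Real.pi / 2 * x)| ≤ 1 * 1 :=
      mul_le_mul (Real.abs_sin_le_one _) (Real.abs_cos_le_one _) (abs_nonneg _) zero_le_one
    calc _ ≤ Real.pi * (1 * 1) := by gcongr
      _ ≤ 4 := by linarith [Real.pi_le_four]
  have hκc : Continuous κ := by simp only [hκ]; fun_prop
  have hκ'c : Continuous κ' := by simp only [hκ']; fun_prop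
  have hz : Continuous fun p : ℝ × ℝ => ((p.1 : ℂ) + p.2 * Complex.I) := by fun_prop
  have hfd : Continuous fun z => fderiv ℝ W z := hW.continuous_fderiv (by norm_num)
  have hWd : ∀ z, HasFDerivAt W (fderiv ℝ W z) z := fun z =>
    (hW.differentiable (by norm_num) z).hasFDerivAt
  set G : ℝ → ℝ → ℝ := fun x y => κ x * (1 - 4 * y) * W (x + y * Complex.I) with hG
  set Gx : ℝ → ℝ → ℝ := fun x y => κ' x * (1 - 4 * y) * W (x + y * Complex.I) +
    κ x * (1 - 4 * y) * fderiv ℝ W (x + y * Complex.I) 1 with hGx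
  set Gy : ℝ → ℝ → ℝ := fun x y => κ x * (-4) * W (x + y * Complex.I) +
    κ x * (1 - 4 * y) * fderiv ℝ W (x + y * Complex.I) Complex.I with hGy
  have c1 : Continuous fun p : ℝ × ℝ => W (p.1 + p.2 * Complex.I) := hW.continuous.comp hz
  have c2 : ∀ v : ℂ, Continuous fun p : ℝ × ℝ => fderiv ℝ W (p.1 + p.2 * Complex.I) v := fun v =>
    (hfd.comp hz).clm_apply continuous_const
  have c3 : Continuous fun p : ℝ × ℝ => κ p.1 := hκc.comp continuous_fst
  have c4 : Continuous fun p : ℝ × ℝ => κ' p.1 := hκ'c.comp continuous_fst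
  have c5 : Continuous fun p : ℝ × ℝ => 1 - 4 * p.2 := by fun_prop
  have hGc : Continuous (Function.uncurry G) := (c3.mul c5).mul c1
  have hGxc : Continuous (Function.uncurry Gx) :=
    ((c4.mul c5).mul c1).add ((c3.mul c5).mul (c2 1))
  have hGyc : Continuous (Function.uncurry Gy) :=
    ((c3.mul continuous_const).mul c1).add ((c3.mul c5).mul (c2 Complex.I))
  have hdx : ∀ x y : ℝ, HasDerivAt (fun x : ℝ => W (x + y * Complex.I))
      (fderiv ℝ W (x + y * Complex.I) 1) x := by
    intro x y
    have h1 : HasDerivAt (fun x : ℝ => ((x : ℂ) + y * Complex.I)) 1 x :=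
      (Complex.ofRealCLM.hasDerivAt (x := x)).add_const _
    exact (hWd _).comp_hasDerivAt x h1
  have hdy : ∀ x y : ℝ, HasDerivAt (fun y : ℝ => W (x + y * Complex.I))
      (fderiv ℝ W (x + y * Complex.I) Complex.I) y := by
    intro x y
    have h1 : HasDerivAt (fun y : ℝ => ((x : ℂ) + y * Complex.I)) (1 * Complex.I) y :=
      ((Complex.ofRealCLM.hasDerivAt (x := y)).mul_const _).const_add _
    rw [one_mul] at h1
    exact (hWd _).comp_hasDerivAt y h1
  have htr := sum_abs_mul_sq_norm_trace_le (h := 1 / 4) (by norm_num) hGc hGxc hGyc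
    (fun x y => ((hκd x).mul_const (1 - 4 * y)).mul (hdx x y))
    (fun x y => by
      have h1 : HasDerivAt (fun y : ℝ => κ x * (1 - 4 * y)) (κ x * (-4)) y := by
        have := (((hasDerivAt_id y).const_mul 4).const_sub 1).const_mul (κ x)
        simpa using this
      exact h1.mul (hdy x y))
    (fun y => by simp [hG, hκ]) (fun y => by simp [hG, hκ]) (fun x => by simp [hG]) S
  have hleft : ∀ x : ℝ, G x 0 = Real.sin (Real.pi / 2 * x) ^ 2 * W x := fun x => by
    simp [hG, hκ]
  simp only [hleft] at htr
  refine htr.trans ?_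
  set g : ℂ → ℝ := fun z => (fderiv ℝ W z 1) ^ 2 + (fderiv ℝ W z Complex.I) ^ 2 with hg
  have hgc : Continuous g :=
    ((hfd.clm_apply continuous_const).pow 2).add ((hfd.clm_apply continuous_const).pow 2)
  have hpt : ∀ x y : ℝ, 0 ≤ y → y ≤ 1 / 4 →
      Gx x y ^ 2 + Gy x y ^ 2 ≤ 64 * B ^ 2 + 2 * g (x + y * Complex.I) := by
    intro x y hy0 hy1
    have hB0 : 0 ≤ B := (abs_nonneg _).trans (hB 0)
    have e0 : ∀ a b : ℝ, (a + b) ^ 2 ≤ 2 * a ^ 2 + 2 * b ^ 2 := fun a b => by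
      nlinarith [sq_nonneg (a - b)]
    have hy2 : |1 - 4 * y| ≤ 1 := by rw [abs_le]; constructor <;> linarith
    have hsq : ∀ {s t : ℝ}, |s| ≤ t → s ^ 2 ≤ t ^ 2 := fun h => sq_le_sq' (abs_le.1 h).1 (abs_le.1 h).2
    have e1 : (κ' x * (1 - 4 * y) * W (x + y * Complex.I)) ^ 2 ≤ (4 * 1 * B) ^ 2 := by
      apply hsq
      rw [abs_mul, abs_mul]
      gcongr
      · exact hκ'1 x
      · exact hB _
    have e2 : (κ x * (-4) * W (x + y * Complex.I)) ^ 2 ≤ (1 * 4 * B) ^ 2 := by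
      apply hsq
      rw [abs_mul, abs_mul]
      gcongr
      · exact hκ1 x
      · norm_num
      · exact hB _
    have e3 : (κ x * (1 - 4 * y)) ^ 2 ≤ 1 := by
      have : (κ x * (1 - 4 * y)) ^ 2 ≤ (1 * 1) ^ 2 := by
        apply hsq
        rw [abs_mul]
        exact mul_le_mul (hκ1 x) hy2 (abs_nonneg _) zero_le_one
      linarith
    have e4 : ∀ d : ℝ, (κ x * (1 - 4 * y) * d) ^ 2 ≤ d ^ 2 := fun d => by
      rw [mul_pow]; exact mul_le_of_le_one_left (sq_nonneg d) e3
    have f1 := e0 (κ' x * (1 - 4 * y) * W (x + y * Complex.I))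
      (κ x * (1 - 4 * y) * fderiv ℝ W (x + y * Complex.I) 1)
    have f2 := e0 (κ x * (-4) * W (x + y * Complex.I))
      (κ x * (1 - 4 * y) * fderiv ℝ W (x + y * Complex.I) Complex.I)
    have f3 := e4 (fderiv ℝ W (x + y * Complex.I) 1)
    have f4 := e4 (fderiv ℝ W (x + y * Complex.I) Complex.I)
    simp only [hGx, hGy, hg]
    nlinarith
  have hgz : Continuous fun p : ℝ × ℝ => g (p.1 + p.2 * Complex.I) := hgc.comp hz
  have hpar : ∀ {F : ℝ → ℝ → ℝ}, Continuous (Function.uncurry F) →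
      Continuous fun y => ∫ x in (0 : ℝ)..2, F x y := fun {F} hF =>
    intervalIntegral.continuous_parametric_intervalIntegral_of_continuous'
      (f := fun y x => F x y) (hF.comp continuous_swap) 0 2
  have hsl : ∀ {F : ℝ → ℝ → ℝ}, Continuous (Function.uncurry F) → ∀ y,
      Continuous fun x => F x y := fun hF y => hF.comp (by fun_prop : Continuous fun x => (x, y))
  have hgg : Continuous (Function.uncurry fun x y : ℝ => 64 * B ^ 2 + 2 * g (x + y * Complex.I)) :=
    continuous_const.add (continuous_const.mul hgz)
  have hGG : Continuous (Function.uncurry fun x y : ℝ => Gx x y ^ 2 + Gy x y ^ 2) :=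
    (hGxc.pow 2).add (hGyc.pow 2)
  have hint : ∫ y in (0 : ℝ)..1 / 4, ∫ x in (0 : ℝ)..2, (Gx x y ^ 2 + Gy x y ^ 2) ≤
      ∫ y in (0 : ℝ)..1 / 4, ∫ x in (0 : ℝ)..2, (64 * B ^ 2 + 2 * g (x + y * Complex.I)) := by
    refine intervalIntegral.integral_mono_on (by norm_num) ((hpar hGG).intervalIntegrable _ _)
      ((hpar hgg).intervalIntegrable _ _) fun y hy => ?_
    exact intervalIntegral.integral_mono_on (by norm_num) ((hsl hGG y).intervalIntegrable _ _)
      ((hsl hgg y).intervalIntegrable _ _) fun x _ => hpt x y hy.1 hy.2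
  have hgz' : Continuous (Function.uncurry fun x y : ℝ => g (x + y * Complex.I)) := hgz
  have heval : ∫ y in (0 : ℝ)..1 / 4, ∫ x in (0 : ℝ)..2, (64 * B ^ 2 + 2 * g (x + y * Complex.I)) =
      32 * B ^ 2 + 2 * ∫ y in (0 : ℝ)..1 / 4, ∫ x in (0 : ℝ)..2, g (x + y * Complex.I) := by
    have h1 : ∀ y : ℝ, ∫ x in (0 : ℝ)..2, (64 * B ^ 2 + 2 * g (x + y * Complex.I)) =
        128 * B ^ 2 + 2 * ∫ x in (0 : ℝ)..2, g (x + y * Complex.I) := fun y => by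
      rw [intervalIntegral_const_add_const_mul (hsl hgz' y)]
      ring
    simp only [h1]
    rw [intervalIntegral_const_add_const_mul (hpar hgz')]
    ring
  have hcac := integral_cutoff_mul_fderiv_sq_le hW hL hB hρ hsub
  have hrect := intervalIntegral_intervalIntegral_le_setIntegral_cutoff hgc
    fun z => add_nonneg (sq_nonneg _) (sq_nonneg _)
  -- In total `2(32 B² + 2 · 4 · 7200 |D| B²)`, with `|D|` the area of the ball; 64 is rounded up to
  -- 100.
  nlinarith [sq_nonneg B]

/-! ### Regularisation of bounded subharmonic functions -/

/-- A radial mollifier on `ℂ`, supported in the disc of radius `ε`. -/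
structure IsRadialMollifier (ψ : ℂ → ℝ) (ε : ℝ) : Prop where
  contDiff : ContDiff ℝ 1 ψ
  nonneg : ∀ s, 0 ≤ ψ s
  eq_zero : ∀ s, ε ≤ ‖s‖ → ψ s = 0
  radial : ∀ s t, ‖s‖ = ‖t‖ → ψ s = ψ t
  integral_eq_one : ∫ s, ψ s = 1

theorem IsRadialMollifier.hasCompactSupport {ψ : ℂ → ℝ} {ε : ℝ} (h : IsRadialMollifier ψ ε) :
    HasCompactSupport ψ :=
  HasCompactSupport.intro (isCompact_closedBall (0 : ℂ) ε) fun s hs => h.eq_zero s (by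
    rw [mem_closedBall_zero_iff, not_le] at hs; exact hs.le)

theorem IsRadialMollifier.integrable {ψ : ℂ → ℝ} {ε : ℝ} (h : IsRadialMollifier ψ ε) :
    Integrable ψ volume :=
  h.contDiff.continuous.integrable_of_hasCompactSupport h.hasCompactSupport

theorem exists_isRadialMollifier {ε : ℝ} (hε : 0 < ε) : ∃ ψ, IsRadialMollifier ψ ε := by
  set m : ℂ → ℝ := fun s => Real.smoothTransition (1 - ‖s‖ ^ 2 / ε ^ 2) with hm
  have hcd : ContDiff ℝ 1 m :=
    (Real.smoothTransition.contDiff (n := 1)).comp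
      (contDiff_const.sub ((contDiff_norm_sq ℝ).div_const _))
  have hz : ∀ s, ε ≤ ‖s‖ → m s = 0 := fun s hs => by
    refine Real.smoothTransition.zero_of_nonpos ?_
    have : 1 ≤ ‖s‖ ^ 2 / ε ^ 2 := by rw [le_div_iff₀ (by positivity)]; nlinarith
    linarith
  have hcs : HasCompactSupport m :=
    HasCompactSupport.intro (isCompact_closedBall (0 : ℂ) ε) fun s hs => hz s (by
      rw [mem_closedBall_zero_iff, not_le] at hs; exact hs.le)
  have hnn : ∀ s, 0 ≤ m s := fun s => Real.smoothTransition.nonneg _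
  have hpos : 0 < ∫ s, m s :=
    hcd.continuous.integral_pos_of_hasCompactSupport_nonneg_nonzero hcs hnn (x := 0)
      (by simp [hm])
  refine ⟨fun s => m s / ∫ s, m s, hcd.div_const _, fun s => div_nonneg (hnn s) hpos.le,
    fun s hs => by simp only [hz s hs, zero_div], fun s t hst => by simp only [hm, hst], ?_⟩
  rw [integral_div, div_self hpos.ne']

/-- The convolution of `V` with the mollifier `ψ`. -/
noncomputable def mollify (ψ V : ℂ → ℝ) : ℂ → ℝ :=
  convolution ψ V (ContinuousLinearMap.mul ℝ ℝ) volume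

theorem mollify_apply (ψ V : ℂ → ℝ) (z : ℂ) : mollify ψ V z = ∫ t, ψ t * V (z - t) := rfl

section Mollify

variable {ψ V : ℂ → ℝ} {ε B : ℝ}

theorem IsRadialMollifier.integrable_mul (h : IsRadialMollifier ψ ε) {F : ℂ → ℝ}
    (hF : Measurable F) (hB : ∀ z, |F z| ≤ B) : Integrable (fun t => ψ t * F t) volume :=
  h.integrable.mul_bdd (c := B) hF.aestronglyMeasurable (Filter.Eventually.of_forall hB)

theorem IsRadialMollifier.abs_mollify_le (h : IsRadialMollifier ψ ε) (hB : ∀ z, |V z| ≤ B)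
    (z : ℂ) : |mollify ψ V z| ≤ B := by
  rw [mollify_apply, ← Real.norm_eq_abs]
  calc _ ≤ ∫ t, ψ t * B := by
        refine norm_integral_le_of_norm_le (h.integrable.mul_const B)
          (Filter.Eventually.of_forall fun t => ?_)
        rw [norm_mul, Real.norm_eq_abs, Real.norm_eq_abs, abs_of_nonneg (h.nonneg t)]
        exact mul_le_mul_of_nonneg_left (hB _) (h.nonneg t)
    _ = B := by rw [integral_mul_const, h.integral_eq_one, one_mul]

theorem IsRadialMollifier.mollify_le (h : IsRadialMollifier ψ ε) (hV : Measurable V)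
    (hB : ∀ z, |V z| ≤ B) {z : ℂ} {a : ℝ} (ha : ∀ t, ‖t‖ < ε → V (z - t) ≤ a) :
    mollify ψ V z ≤ a := by
  rw [mollify_apply]
  calc _ ≤ ∫ t, ψ t * a := by
        refine integral_mono (h.integrable_mul (hV.comp (measurable_const.sub measurable_id))
          fun t => hB _) (h.integrable.mul_const a) fun t => ?_
        rcases lt_or_ge ‖t‖ ε with ht | ht
        · exact mul_le_mul_of_nonneg_left (ha t ht) (h.nonneg t)
        · simp only [h.eq_zero t ht, zero_mul, le_refl]
    _ = a := by rw [integral_mul_const, h.integral_eq_one, one_mul]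

theorem IsRadialMollifier.integral_integral_swap_mul (h : IsRadialMollifier ψ ε)
    (hV : Measurable V) (hB : ∀ z, |V z| ≤ B) {γ : ℂ → ℝ → ℂ}
    (hγ : Measurable (Function.uncurry γ)) :
    ∫ θ in (0 : ℝ)..2 * Real.pi, ∫ t, ψ t * V (γ t θ) =
      ∫ t, ψ t * ∫ θ in (0 : ℝ)..2 * Real.pi, V (γ t θ) := by
  simp only [intervalIntegral.integral_of_le (by positivity : 0 ≤ 2 * Real.pi),
    ← integral_const_mul]
  refine (integral_integral_swap ?_).symm
  have h1 : Integrable (fun p : ℂ × ℝ => ψ p.1)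
      (volume.prod (volume.restrict (Set.Ioc 0 (2 * Real.pi)))) := h.integrable.comp_fst _
  exact h1.mul_bdd (c := B) (hV.comp hγ).aestronglyMeasurable
    (Filter.Eventually.of_forall fun p => hB _)

/-- A convolution with a nonnegative kernel is a superposition of translates, each of which
satisfies the inequality. -/
theorem IsRadialMollifier.mollify_le_circleAverage (h : IsRadialMollifier ψ ε)
    (hV : Measurable V) (hB : ∀ z, |V z| ≤ B) {z : ℂ} {r : ℝ}
    (hsub : ∀ t, ‖t‖ < ε → V (z - t) ≤ Real.circleAverage V (z - t) r) :
    mollify ψ V z ≤ Real.circleAverage (mollify ψ V) z r := by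
  rw [Real.circleAverage_def, smul_eq_mul, inv_mul_eq_div, le_div_iff₀ (by positivity)]
  simp only [mollify_apply]
  have hγ : Measurable (Function.uncurry fun (t : ℂ) (θ : ℝ) => circleMap z r θ - t) := by
    refine Continuous.measurable ?_
    unfold circleMap Function.uncurry; fun_prop
  rw [h.integral_integral_swap_mul hV hB hγ, ← integral_mul_const]
  refine integral_mono ?_ ?_ fun t => ?_
  · exact (h.integrable_mul (hV.comp (measurable_const.sub measurable_id)) fun t => hB _).mul_const _
  · have hm : Measurable fun t : ℂ => ∫ θ in (0 : ℝ)..2 * Real.pi, V (circleMap z r θ - t) := by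
      simp only [intervalIntegral.integral_of_le (by positivity : 0 ≤ 2 * Real.pi)]
      have hs : StronglyMeasurable (Function.uncurry fun (t : ℂ) (θ : ℝ) =>
          V (circleMap z r θ - t)) := (hV.comp hγ).stronglyMeasurable
      exact hs.integral_prod_right.measurable
    refine h.integrable_mul (B := B * |2 * Real.pi - 0|) hm fun t => ?_
    exact intervalIntegral.norm_integral_le_of_norm_le_const (C := B)
        (f := fun θ : ℝ => V (circleMap z r θ - t)) fun θ _ => hB _
  · show ψ t * V (z - t) * (2 * Real.pi) ≤
      ψ t * ∫ θ in (0 : ℝ)..2 * Real.pi, V (circleMap z r θ - t)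
    rw [mul_assoc]
    rcases lt_or_ge ‖t‖ ε with ht | ht
    · refine mul_le_mul_of_nonneg_left ?_ (h.nonneg t)
      have h1 := hsub t ht
      rw [Real.circleAverage_def, smul_eq_mul, inv_mul_eq_div, le_div_iff₀ (by positivity)] at h1
      refine h1.trans (le_of_eq ?_)
      congr 1; ext θ; congr 1
      simp only [circleMap]; ring
    · simp only [h.eq_zero t ht, zero_mul, le_refl]

theorem integral_rotate_eq_circleAverage (V : ℂ → ℝ) (z t : ℂ) :
    ∫ θ in (0 : ℝ)..2 * Real.pi, V (z - Complex.exp (θ * Complex.I) * t) =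
      2 * Real.pi * Real.circleAverage V z ‖t‖ := by
  rw [Real.circleAverage_eq_integral_add (Complex.arg (-t)), smul_eq_mul, ← mul_assoc,
    mul_inv_cancel₀ (by positivity), one_mul]
  congr 1; ext θ; congr 1
  have h := Complex.norm_mul_exp_arg_mul_I (-t)
  rw [norm_neg] at h
  simp only [circleMap]
  push_cast
  rw [add_mul, Complex.exp_add]
  linear_combination (Complex.exp (θ * Complex.I)) * (-h)

/-- Radial symmetry allows `t` to be rotated freely; averaging over the rotations replaces `V (z -
t)` by the circle average at radius `‖t‖`, which is at least `V z`. -/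
theorem IsRadialMollifier.le_mollify (h : IsRadialMollifier ψ ε)
    (hV : Measurable V) (hB : ∀ z, |V z| ≤ B) {z : ℂ}
    (hsub : ∀ r, 0 < r → r < ε → V z ≤ Real.circleAverage V z r) :
    V z ≤ mollify ψ V z := by
  have hrot : ∀ θ : ℝ, ∫ t, ψ t * V (z - Complex.exp (θ * Complex.I) * t) = mollify ψ V z := by
    intro θ
    rw [mollify_apply]
    have hmp := (rotation (Circle.exp θ)).measurePreserving
    rw [← hmp.integral_comp (rotation (Circle.exp θ)).toMeasurableEquiv.measurableEmbedding
      (fun t => ψ t * V (z - t))]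
    congr 1; ext t
    rw [rotation_apply, Circle.coe_exp, h.radial t (Complex.exp (θ * Complex.I) * t) (by simp)]
  have hγ : Measurable (Function.uncurry fun (t : ℂ) (θ : ℝ) =>
      z - Complex.exp (θ * Complex.I) * t) := by
    refine Continuous.measurable ?_
    unfold Function.uncurry; fun_prop
  have h1 := h.integral_integral_swap_mul hV hB hγ
  simp only [hrot, integral_rotate_eq_circleAverage, intervalIntegral.integral_const,
    smul_eq_mul, sub_zero] at h1
  have hm : Measurable fun t : ℂ => 2 * Real.pi * Real.circleAverage V z ‖t‖ := by
    simp only [← integral_rotate_eq_circleAverage,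
      intervalIntegral.integral_of_le (by positivity : 0 ≤ 2 * Real.pi)]
    have hs : StronglyMeasurable (Function.uncurry fun (t : ℂ) (θ : ℝ) =>
        V (z - Complex.exp (θ * Complex.I) * t)) := (hV.comp hγ).stronglyMeasurable
    exact hs.integral_prod_right.measurable
  have h2 : ∫ t, ψ t * (2 * Real.pi * V z) ≤
      ∫ t, ψ t * (2 * Real.pi * Real.circleAverage V z ‖t‖) := by
    refine integral_mono (h.integrable.mul_const _)
      (h.integrable_mul (B := B * |2 * Real.pi - 0|) hm fun t => ?_) fun t => ?_
    · rw [← integral_rotate_eq_circleAverage]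
      exact intervalIntegral.norm_integral_le_of_norm_le_const (C := B)
        (f := fun θ : ℝ => V (z - Complex.exp (θ * Complex.I) * t)) fun θ _ => hB _
    · show ψ t * (2 * Real.pi * V z) ≤ ψ t * (2 * Real.pi * Real.circleAverage V z ‖t‖)
      rcases lt_or_ge ‖t‖ ε with ht | ht
      · refine mul_le_mul_of_nonneg_left (mul_le_mul_of_nonneg_left ?_ (by positivity)) (h.nonneg t)
        rcases (norm_nonneg t).eq_or_lt with h0 | h0
        · rw [← h0, Real.circleAverage_zero]
        · exact hsub _ h0 ht
      · simp only [h.eq_zero t ht, zero_mul, le_refl]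
  rw [← h1, integral_mul_const, h.integral_eq_one, one_mul] at h2
  exact le_of_mul_le_mul_left h2 (by positivity)

theorem IsRadialMollifier.contDiff_mollify (h : IsRadialMollifier ψ ε)
    (hV : LocallyIntegrable V volume) : ContDiff ℝ 1 (mollify ψ V) :=
  h.hasCompactSupport.contDiff_convolution_left (n := 1) _ h.contDiff hV

theorem IsRadialMollifier.hasCompactSupport_mollify (h : IsRadialMollifier ψ ε)
    (hV : HasCompactSupport V) : HasCompactSupport (mollify ψ V) :=
  HasCompactSupport.convolution _ h.hasCompactSupport hV

end Mollify

/-! ### The `H^{1/2}` energy of traces of bounded subharmonic functions -/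

theorem UpperSemicontinuousOn.measurable_indicator {v : ℂ → ℝ} {U : Set ℂ} (hU : IsOpen U)
    (hv : UpperSemicontinuousOn v U) : Measurable (U.indicator v) := by
  refine measurable_of_Iio fun c => ?_
  obtain ⟨w, hw, hwU⟩ := upperSemicontinuousOn_iff_preimage_Iio.1 hv c
  have h : U.indicator v ⁻¹' Set.Iio c = (U ∩ w) ∪ (Uᶜ ∩ {_z | 0 < c}) := by
    rw [← hwU]
    ext z
    by_cases hz : z ∈ U <;> simp [hz]
  rw [h]
  exact (hU.inter hw).measurableSet.union (hU.measurableSet.compl.inter (MeasurableSet.const _))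

namespace IsBoundedSubharmonicExtension

variable {v : ℂ → ℝ} {u : UnitAddCircle → ℝ} {B : ℝ}

theorem bound_nonneg (h : IsBoundedSubharmonicExtension v u B) : 0 ≤ B :=
  (abs_nonneg _).trans (h.abs_le 0 (by simp))

theorem abs_le_bound (h : IsBoundedSubharmonicExtension v u B) (x : UnitAddCircle) : |u x| ≤ B := by
  induction x using QuotientAddGroup.induction_on with
  | H x =>
  have := h.extends_real x
  change |u (x : UnitAddCircle)| ≤ B
  rw [← this]
  exact h.abs_le _ (by simp)

theorem measurable (h : IsBoundedSubharmonicExtension v u B) : Measurable u := by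
  refine measurable_of_Iio fun c => IsOpen.measurableSet ?_
  rw [← (QuotientAddGroup.isQuotientMap_mk (N := AddSubgroup.zmultiples (1 : ℝ))).isOpen_preimage]
  obtain ⟨w, hw, hwU⟩ := upperSemicontinuousOn_iff_preimage_Iio.1
    h.subharmonicOn.upperSemicontinuousOn c
  have hset : (QuotientAddGroup.mk ⁻¹' (u ⁻¹' Set.Iio c) : Set ℝ) =
      (fun x : ℝ => (x : ℂ)) ⁻¹' w := by
    ext x
    have h1 := Set.ext_iff.1 hwU (x : ℂ)
    have h2 := h.extends_real x
    simp only [Set.mem_inter_iff, Set.mem_ofPred_eq, Complex.ofReal_im, abs_zero, zero_lt_one,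
      Set.mem_preimage, Set.mem_Iio, true_and] at h1
    rw [h2] at h1
    exact h1
  exact hset ▸ hw.preimage Complex.continuous_ofReal

/-- The smooth estimate has a constant independent of the smoothness of `W`, so it passes to the
limit along mollifications of the extension. -/
theorem sum_abs_mul_sq_norm_fourierCoeff_le (h : IsBoundedSubharmonicExtension v u B)
    (S : Finset ℤ) :
    ∑ k ∈ S, |(k : ℝ)| * ‖fourierCoeff (fun x => (u x : ℂ)) k‖ ^ 2 ≤
      (115200 * volume.real (Metric.closedBall (1 : ℂ) 3) + 100) * B ^ 2 := by
  -- Truncation makes the function globally bounded and compactly supported. The radius 20 is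
  -- generous: only discs of radius below `1/2` about points of the ball of centre 1 and radius 3
  -- matter.
  set U : Set ℂ := {z : ℂ | |z.im| < 1} ∩ Metric.ball 0 20 with hU
  have hUo : IsOpen U := h.subharmonicOn.isOpen.inter Metric.isOpen_ball
  set V : ℂ → ℝ := U.indicator v with hV
  have hVm : Measurable V := UpperSemicontinuousOn.measurable_indicator hUo
    (h.subharmonicOn.upperSemicontinuousOn.mono Set.inter_subset_left)
  have hVB : ∀ z, |V z| ≤ B := fun z => by
    by_cases hz : z ∈ U
    · rw [hV, Set.indicator_of_mem hz]; exact h.abs_le z hz.1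
    · rw [hV, Set.indicator_of_notMem hz, abs_zero]; exact h.bound_nonneg
  have hVc : HasCompactSupport V :=
    HasCompactSupport.intro (isCompact_closedBall (0 : ℂ) 20) fun z hz =>
      Set.indicator_of_notMem (fun hz' => hz (Metric.ball_subset_closedBall hz'.2)) _
  have hVi : LocallyIntegrable V volume := by
    refine Integrable.locallyIntegrable ((integrableOn_iff_integrable_of_support_subset
      (Set.support_indicator_subset : Function.support V ⊆ U)).1 ?_)
    have hfin : volume U < ⊤ :=
      (measure_mono Set.inter_subset_right).trans_lt measure_ball_lt_top
    exact Measure.integrableOn_of_bounded hfin.ne hVm.aestronglyMeasurable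
      (Filter.Eventually.of_forall hVB)
  have hsubV : ∀ z r, 0 < r → Metric.closedBall z r ⊆ U → V z ≤ Real.circleAverage V z r := by
    intro z r hr hzr
    have h1 := h.subharmonicOn.le_circleAverage z r hr (hzr.trans Set.inter_subset_left)
    have h2 : Real.circleAverage V z r = Real.circleAverage v z r := by
      refine Real.circleAverage_congr_sphere fun w hw => Set.indicator_of_mem (hzr ?_) _
      rw [abs_of_pos hr] at hw
      exact Metric.sphere_subset_closedBall hw
    rw [h2, hV, Set.indicator_of_mem (hzr (Metric.mem_closedBall_self hr.le))]
    exact h1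
  have hball : ∀ z ∈ Metric.closedBall (1 : ℂ) 3, |z.im| ≤ 1 / 2 → ∀ s, s < 1 / 2 →
      ∀ w, ‖w - z‖ ≤ s → w ∈ U := by
    intro z hz hzi s hs w hw
    rw [Metric.mem_closedBall, dist_eq_norm] at hz
    refine ⟨?_, ?_⟩
    · have h1 := Complex.abs_im_le_norm (w - z)
      have h2 : |w.im| ≤ |(w - z).im| + |z.im| := by
        have := abs_add_le ((w - z).im) z.im
        rwa [Complex.sub_im, sub_add_cancel] at this
      show |w.im| < 1
      linarith
    · rw [mem_ball_zero_iff]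
      have h1 : ‖w‖ ≤ ‖w - z‖ + ‖z - 1‖ + ‖(1 : ℂ)‖ := by
        have := norm_add₃_le (a := w - z) (b := z - 1) (c := 1)
        rwa [sub_add_sub_cancel, sub_add_cancel] at this
      rw [norm_one] at h1
      linarith
  have hreal : ∀ x ∈ Set.Icc (0 : ℝ) 2, (x : ℂ) ∈ Metric.closedBall (1 : ℂ) 3 ∧
      |(x : ℂ).im| ≤ 1 / 2 := by
    intro x hx
    refine ⟨?_, by simp⟩
    rw [Metric.mem_closedBall, dist_eq_norm, ← Complex.ofReal_one, ← Complex.ofReal_sub,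
      Complex.norm_real, Real.norm_eq_abs, _root_.abs_le]
    constructor <;> linarith [hx.1, hx.2]
  -- Mollification radius and circle radius both stay within `1/4`, so their sum keeps points with
  -- `|Im z| ≤ 1/2` inside the strip.
  set e : ℕ → ℝ := fun n => 1 / ((n : ℝ) + 1) / 4 with he
  have he0 : ∀ n, 0 < e n := fun n => by simp only [he]; positivity
  have he1 : ∀ n, e n ≤ 1 / 4 := fun n => by
    simp only [he]
    have : 1 / ((n : ℝ) + 1) ≤ 1 := by
      rw [div_le_one (by positivity)]; linarith [Nat.cast_nonneg (α := ℝ) n]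
    linarith
  have helim : Filter.Tendsto e Filter.atTop (nhds 0) := by
    have := (tendsto_one_div_add_atTop_nhds_zero_nat (𝕜 := ℝ)).div_const 4
    rwa [zero_div] at this
  choose ψ hψ using fun n => exists_isRadialMollifier (he0 n)
  set W : ℕ → ℂ → ℝ := fun n => mollify (ψ n) V with hW
  have hWcd : ∀ n, ContDiff ℝ 1 (W n) := fun n => (hψ n).contDiff_mollify hVi
  have hWB : ∀ n z, |W n z| ≤ B := fun n z => (hψ n).abs_mollify_le hVB z
  -- From below by the sub-mean-value property, from above by upper semicontinuity; continuity of
  -- the extension is not needed.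
  have hlim : ∀ x ∈ Set.Icc (0 : ℝ) 2,
      Filter.Tendsto (fun n => W n x) Filter.atTop (nhds (u (x : UnitAddCircle))) := by
    intro x hx
    obtain ⟨hx1, hx2⟩ := hreal x hx
    have hxU : (x : ℂ) ∈ U := hball _ hx1 hx2 0 (by norm_num) _ (by simp)
    have hVx : V x = u (x : UnitAddCircle) := by
      rw [hV, Set.indicator_of_mem hxU, h.extends_real]
    have hlow : ∀ n, u (x : UnitAddCircle) ≤ W n x := by
      intro n
      rw [← hVx]
      refine (hψ n).le_mollify hVm hVB fun r hr0 hr1 => hsubV _ r hr0 fun w hw => ?_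
      refine hball _ hx1 hx2 r (by linarith [he1 n]) w ?_
      rwa [Metric.mem_closedBall, dist_eq_norm] at hw
    rw [tendsto_order]
    refine ⟨fun a ha => Filter.Eventually.of_forall fun n => ha.trans_le (hlow n), fun a ha => ?_⟩
    obtain ⟨a', ha1, ha2⟩ := exists_between ha
    have husc := h.subharmonicOn.upperSemicontinuousOn.mono
      (Set.inter_subset_left : U ⊆ {z : ℂ | |z.im| < 1}) (x : ℂ) hxU a'
      (by show v (x : ℂ) < a'; rw [h.extends_real]; exact ha1)
    rw [hUo.nhdsWithin_eq hxU, Metric.eventually_nhds_iff] at husc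
    obtain ⟨d, hd0, hd⟩ := husc
    filter_upwards [helim.eventually (gt_mem_nhds hd0)] with n hn
    refine lt_of_le_of_lt ((hψ n).mollify_le hVm hVB (a := a') fun t ht => ?_) ha2
    have hmem : (x : ℂ) - t ∈ U := hball _ hx1 hx2 (1 / 4) (by norm_num) _
      (by rw [sub_sub_cancel_left, norm_neg]; exact ht.le.trans (he1 n))
    rw [hV, Set.indicator_of_mem hmem]
    exact (hd (by rw [dist_eq_norm, sub_sub_cancel_left, norm_neg]; exact ht.trans hn)).le
  have hfinite : ∀ n, ∑ k ∈ S, |(k : ℝ)| * ‖∫ x in (0 : ℝ)..2, fourier (-k) (x : UnitAddCircle) *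
        ((Real.sin (Real.pi / 2 * x) ^ 2 * W n x : ℝ) : ℂ)‖ ^ 2 ≤
      (115200 * volume.real (Metric.closedBall (1 : ℂ) 3) + 100) * B ^ 2 := by
    intro n
    obtain ⟨L, hL⟩ := (hWcd n).lipschitzWith_of_hasCompactSupport
      ((hψ n).hasCompactSupport_mollify hVc) one_ne_zero
    refine sum_abs_mul_sq_norm_fourier_cutoff_le (hWcd n) hL (hWB n) (ρ := 1 / 4) (by norm_num)
      (fun z hz hzi r hr0 hr1 => ?_) S
    refine (hψ n).mollify_le_circleAverage hVm hVB fun t ht => hsubV _ r hr0 fun w hw => ?_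
    refine hball z hz hzi (r + ‖t‖) (by linarith [he1 n]) w ?_
    rw [Metric.mem_closedBall, dist_eq_norm] at hw
    calc ‖w - z‖ = ‖(w - (z - t)) - t‖ := by congr 1; ring
      _ ≤ ‖w - (z - t)‖ + ‖t‖ := norm_sub_le _ _
      _ ≤ r + ‖t‖ := by gcongr
  have hsin : ∀ x : ℝ, |Real.sin (Real.pi / 2 * x) ^ 2| ≤ 1 := fun x => by
    rw [abs_pow]; exact pow_le_one₀ (abs_nonneg _) (Real.abs_sin_le_one _)
  have hum : Measurable fun x : ℝ => u (x : UnitAddCircle) :=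
    h.measurable.comp (AddCircle.continuous_mk' 1).measurable
  have hconv : ∀ k : ℤ, Filter.Tendsto (fun n => ∫ x in (0 : ℝ)..2,
        fourier (-k) (x : UnitAddCircle) *
          ((Real.sin (Real.pi / 2 * x) ^ 2 * W n x : ℝ) : ℂ)) Filter.atTop
      (nhds (∫ x in (0 : ℝ)..2, fourier (-k) (x : UnitAddCircle) *
        ((Real.sin (Real.pi / 2 * x) ^ 2 * u (x : UnitAddCircle) : ℝ) : ℂ))) := by
    intro k
    refine intervalIntegral.tendsto_integral_filter_of_dominated_convergence (fun _ => B)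
      ?_ ?_ intervalIntegrable_const ?_
    · refine Filter.Eventually.of_forall fun n => Continuous.aestronglyMeasurable ?_
      refine (fourier_coe_unitAddCircle_continuous (-k)).mul (Complex.continuous_ofReal.comp ?_)
      exact Continuous.mul (by fun_prop) ((hWcd n).continuous.comp Complex.continuous_ofReal)
    · refine Filter.Eventually.of_forall fun n => Filter.Eventually.of_forall fun x _ => ?_
      rw [norm_mul, norm_fourier_apply, one_mul, Complex.norm_real, norm_mul, ← one_mul B]
      exact mul_le_mul (hsin x) (hWB n x) (norm_nonneg _) zero_le_one
    · refine Filter.Eventually.of_forall fun x hx => ?_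
      rw [Set.uIoc_of_le (by norm_num)] at hx
      exact (((Complex.continuous_ofReal.tendsto _).comp
        ((hlim x (Set.Ioc_subset_Icc_self hx)).const_mul _)).const_mul _)
  -- Folding `[1,2]` onto `[0,1]` turns `sin²` into `cos²` and leaves the periodic factors
  -- unchanged, so the weights add up to 1.
  have hident : ∀ k : ℤ, ∫ x in (0 : ℝ)..2, fourier (-k) (x : UnitAddCircle) *
        ((Real.sin (Real.pi / 2 * x) ^ 2 * u (x : UnitAddCircle) : ℝ) : ℂ) =
      fourierCoeff (fun x => (u x : ℂ)) k := by
    intro k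
    set F : ℝ → ℂ := fun x => fourier (-k) (x : UnitAddCircle) *
        ((Real.sin (Real.pi / 2 * x) ^ 2 * u (x : UnitAddCircle) : ℝ) : ℂ) with hF
    have hFm : Measurable F :=
      (fourier_coe_unitAddCircle_continuous (-k)).measurable.mul
        (Complex.measurable_ofReal.comp (Measurable.mul (by fun_prop) hum))
    have hFi : ∀ a b : ℝ, IntervalIntegrable F volume a b := fun a b => by
      refine (intervalIntegrable_const (c := B)).mono_fun hFm.aestronglyMeasurable
        (Filter.Eventually.of_forall fun x => ?_)
      simp only [hF]
      rw [norm_mul, norm_fourier_apply, one_mul, Complex.norm_real, norm_mul, ← one_mul B]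
      refine (mul_le_mul (hsin x) (h.abs_le_bound _) (abs_nonneg _) zero_le_one).trans ?_
      exact le_abs_self _
    have hF1 : ∫ x in (1 : ℝ)..2, F x = ∫ x in (0 : ℝ)..1, F (x + 1) := by
      rw [intervalIntegral.integral_comp_add_right]; norm_num
    have hF1i : IntervalIntegrable (fun x => F (x + 1)) volume 0 1 := by
      have := (hFi 1 2).comp_add_right 1
      norm_num at this
      exact this
    rw [← intervalIntegral.integral_add_adjacent_intervals (hFi 0 1) (hFi 1 2), hF1,
      ← intervalIntegral.integral_add (hFi 0 1) hF1i, fourierCoeff_eq_integral_volume,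
      ← UnitAddCircle.intervalIntegral_preimage 0, zero_add]
    congr 1; ext x
    have hs : Real.sin (Real.pi / 2 * (x + 1)) = Real.cos (Real.pi / 2 * x) := by
      rw [mul_add, mul_one, Real.sin_add_pi_div_two]
    have hper : ((x + 1 : ℝ) : UnitAddCircle) = (x : UnitAddCircle) := AddCircle.coe_add_period 1 x
    simp only [hF, hs, hper]
    have hsc : ((Real.sin (Real.pi / 2 * x) : ℝ) : ℂ) ^ 2 +
        ((Real.cos (Real.pi / 2 * x) : ℝ) : ℂ) ^ 2 = 1 := by
      exact_mod_cast Real.sin_sq_add_cos_sq (Real.pi / 2 * x)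
    simp only [Complex.ofReal_mul, Complex.ofReal_pow]
    linear_combination (fourier (-k) (x : UnitAddCircle) * (u (x : UnitAddCircle) : ℂ)) * hsc
  refine le_of_tendsto (x := Filter.atTop) (tendsto_finsetSum S fun k _ =>
    (((hident k ▸ hconv k).norm.pow 2).const_mul |(k : ℝ)|)) ?_
  exact Filter.Eventually.of_forall hfinite

end IsBoundedSubharmonicExtension

/-! ### Assembly of the theorem from large and small `M` -/

theorem integral_fejerAverage {u : UnitAddCircle → ℝ} (hu : Measurable u) {B : ℝ}
    (hB : ∀ x, |u x| ≤ B) (ω : UnitAddCircle) {M : ℕ} (hM : 1 ≤ M) :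
    ∫ x : UnitAddCircle, fejerAverage u ω M x = ∫ x : UnitAddCircle, u x := by
  have h := fourierCoeff_fejerAverage hu hB ω M 0
  rw [fejerMultiplier_zero ω hM, one_mul, fourierCoeff_eq_integral_volume,
    fourierCoeff_eq_integral_volume] at h
  simp only [neg_zero, fourier_zero, one_mul] at h
  have h1 : ∫ x : UnitAddCircle, (fejerAverage u ω M x : ℂ) =
      ((∫ x : UnitAddCircle, fejerAverage u ω M x : ℝ) : ℂ) := integral_ofReal
  have h2 : ∫ x : UnitAddCircle, (u x : ℂ) = ((∫ x : UnitAddCircle, u x : ℝ) : ℂ) :=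
    integral_ofReal
  rw [h1, h2] at h
  exact_mod_cast h

theorem theorem2p3 (A : ℝ) :
    ∃ σ : ℝ, 0 < σ ∧
      ∀ (c : ℝ), 0 < c → ∀ (B : ℝ), ∃ c' : ℝ, 0 < c' ∧
        ∀ (u : UnitAddCircle → ℝ) (v : ℂ → ℝ), IsBoundedSubharmonicExtension v u B →
        ∀ (ω : UnitAddCircle) (M : ℕ), 1 ≤ M →
          (∀ k : ℤ, 0 < |k| → |k| ≤ (M : ℤ) → c * |(k : ℝ)| ^ (-A) < ‖k • ω‖) →
          MeasureTheory.volume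
              {x : UnitAddCircle |
                (M : ℝ) ^ (-σ) < |fejerAverage u ω M x - ∫ y : UnitAddCircle, u y|}
            < ENNReal.ofReal (Real.exp (-(c' * (M : ℝ) ^ σ))) := by
  -- For negative `A` the hypothesis is stronger than the one with exponent 0, since `|k| ≥ 1`; so
  -- the exponent may be taken nonnegative.
  set A' : ℝ := max A 0 with hA'
  have hA0 : 0 ≤ A' := le_max_right _ _
  set σ : ℝ := 1 / (4 * (1 + A')) with hσ
  have hσ0 : 0 < σ := by positivity
  refine ⟨σ, hσ0, fun c hc B => ?_⟩
  set E : ℝ := (115200 * volume.real (Metric.closedBall (1 : ℂ) 3) + 100) * B ^ 2 with hE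
  obtain ⟨M₀, hM₀⟩ := exists_large_scale_fejerAverage_deviation_lt hA0 hc E hσ
  set N : ℝ := (M₀ : ℝ) + 1 with hN
  have hN0 : 0 < N := by positivity
  have hNσ : 0 < N ^ σ := by positivity
  obtain ⟨δ, hδ0, hδ⟩ := exists_measure_near_mean_ge B E (by positivity : 0 < N ^ (-σ))
  -- `1/2` is the rate for large `M`. For `M < M₀` the second entry gives `c' M^σ ≤ δ/2`, and `1 - δ
  -- < 1 - δ/2 ≤ exp(-c' M^σ)`.
  refine ⟨min (1 / 2) (δ / (2 * N ^ σ)), lt_min (by norm_num) (by positivity), ?_⟩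
  intro u v huv ω M hM hω
  have hum := huv.measurable
  have huB := huv.abs_le_bound
  have huE := huv.sum_abs_mul_sq_norm_fourierCoeff_le
  have hM' : (1 : ℝ) ≤ M := by exact_mod_cast hM
  have hMσ : 0 < (M : ℝ) ^ σ := by positivity
  by_cases hMM : M₀ ≤ M
  · refine (hM₀ u B hum huB huE ω M hM hMM fun k hk0 hkM => ?_).trans_le ?_
    · refine lt_of_le_of_lt ?_ (hω k hk0 hkM)
      have hk1 : (1 : ℝ) ≤ |(k : ℝ)| := by exact_mod_cast hk0
      exact mul_le_mul_of_nonneg_left (Real.rpow_le_rpow_of_exponent_le hk1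
        (neg_le_neg (le_max_left _ _))) hc.le
    · refine ENNReal.ofReal_le_ofReal (Real.exp_le_exp.2 (neg_le_neg ?_))
      exact mul_le_mul_of_nonneg_right (min_le_left _ _) hMσ.le
  · have hMN : (M : ℝ) ≤ N := by
      have : (M : ℝ) ≤ M₀ := by exact_mod_cast (not_le.1 hMM).le
      linarith
    -- `f` keeps the mean of `u`, the bound `B` and the energy bound `E`, as the multiplier has
    -- modulus at most 1. Closeness to the mean within `N^(-σ) ≤ M^(-σ)` on a set of measure `δ` is
    -- therefore uniform in `M` and `ω`.
    set f := fejerAverage u ω M with hf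
    have hfm : Measurable f := measurable_fejerAverage hum ω M
    have hfE : ∀ S : Finset ℤ,
        ∑ k ∈ S, |(k : ℝ)| * ‖fourierCoeff (fun x => (f x : ℂ)) k‖ ^ 2 ≤ E := by
      intro S
      refine (Finset.sum_le_sum fun k _ => ?_).trans (huE S)
      rw [hf, fourierCoeff_fejerAverage hum huB, norm_mul]
      gcongr
      exact mul_le_of_le_one_left (norm_nonneg _) (norm_fejerMultiplier_le_one ω hM k)
    have hnear := hδ f hfm (abs_fejerAverage_le huB ω hM) hfE
    rw [hf, integral_fejerAverage hum huB ω hM, ← hf] at hnear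
    set a : ℝ := ∫ y : UnitAddCircle, u y with ha
    set Z : Set UnitAddCircle := {x | |f x - a| ≤ N ^ (-σ)} with hZ
    have hZm : MeasurableSet Z := measurableSet_le (hfm.sub measurable_const).abs measurable_const
    have hsub : {x : UnitAddCircle | (M : ℝ) ^ (-σ) < |f x - a|} ⊆ Zᶜ := by
      intro x (hx : (M : ℝ) ^ (-σ) < |f x - a|) (hxZ : |f x - a| ≤ N ^ (-σ))
      have : N ^ (-σ) ≤ (M : ℝ) ^ (-σ) :=
        Real.rpow_le_rpow_of_nonpos (by linarith) hMN (by linarith)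
      linarith
    have hcompl : volume.real Zᶜ ≤ 1 - δ := by
      have h1 := measureReal_compl (μ := (volume : Measure UnitAddCircle)) hZm
      have h2 : volume.real (Set.univ : Set UnitAddCircle) = 1 := by
        rw [measureReal_def, UnitAddCircle.measure_univ, ENNReal.toReal_one]
      rw [h1, h2]
      linarith
    calc _ ≤ volume Zᶜ := measure_mono hsub
      _ = ENNReal.ofReal (volume.real Zᶜ) := by
          rw [measureReal_def, ENNReal.ofReal_toReal (measure_ne_top _ _)]
      _ < _ := by
          rw [ENNReal.ofReal_lt_ofReal_iff (Real.exp_pos _)]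
          have h1 : min (1 / 2) (δ / (2 * N ^ σ)) * (M : ℝ) ^ σ ≤ δ / 2 := by
            calc _ ≤ δ / (2 * N ^ σ) * N ^ σ :=
                  mul_le_mul (min_le_right _ _)
                    (Real.rpow_le_rpow (by positivity) hMN hσ0.le) hMσ.le (by positivity)
              _ = δ / 2 := by field_simp
          have h2 := Real.add_one_le_exp (-(min (1 / 2) (δ / (2 * N ^ σ)) * (M : ℝ) ^ σ))
          linarith
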